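/- \textbf{Theorem.} \emph{Setting.} Let $T,N\ge 1$, let $x_0$ be given, and for every stage $t\in\{1,\dots,T\}$ let $\xi_t^i=(c_t^i,b_t^i,A_t^i,B_t^i)$, $i\in[N]$, be the observed parameters, where $\xi_1^i=\xi_1$ does not depend on $i$. Write $\mathcal X_t(x,\xi_t)=\{x'\in\mathbb R^{d_t}_+: A_tx'+B_tx=b_t\}$. Assume relatively complete recourse: $\mathcal X_t(x_{t-1},\xi_t^i)$ is nonempty and compact for all $t$, all $i$ and every reachable state $x_{t-1}$ (the reachable states are $x_0$ and, recursively, all points of $\mathcal X_t(x_{t-1},\xi^i_t)$ with $x_{t-1}$ reachable and $i\in[N]$). For a bandwidth $h>0$ let $$\hat w_t^i(\xi)=\frac{e^{-\|\xi-\xi_t^i\|_2/h}}{\sum_{l\in[N]}e^{-\|\xi-\xi_t^l\|_2/h}},$$ and for $\lambda\ge0$ let $\mathcal P_t^\lambda(\xi)$ be the set of $w\in\mathbb R^N_+$ with $\sum_i w_i=1$, $\sum_i|w_i-\hat w_t^i(\xi)|/\sqrt{\hat w_t^i(\xi)}\le\sqrt N\lambda$ and $\max_i|w_i-\hat w_t^i(\xi)|/\sqrt{\hat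 w_t^i(\xi)}\le\lambda$. Define $\hat Q_{T+1}\equiv0$ and, for $t=T,\dots,1$, $$\hat Q_t(x,\xi_t^i)=\min_{x'\in\mathcal X_t(x,\xi_t^i)}\Big\{(c_t^i)^\top x'+\max_{w\in\mathcal P_t^\lambda(\xi_t^i)}\sum_{j\in[N]}w_j\,\hat Q_{t+1}(x',\xi_{t+1}^j)\Big\},$$ with value $+\infty$ where infeasible. \emph{Lower and upper bound problems.} For $t<T$ and each $i\in[N]$, the stage-$t$ lower bound problem $\mathrm{LB}_t(x,\xi_t)$, with $\hat w^i=\hat w^i_t(\xi_t)$ and with cuts $\ell\ge G_{ij}^\top x_t+v_{ij}$ for $\hat Q_{t+1}(\cdot,\xi_{t+1}^i)$, is the linear program $$\min\ c_t^\top x_t+\gamma+\lambda\Big(\beta+\sum_i\psi_i\Big)+\sum_i\sqrt{\hat w^i}(\mu_i-\zeta_i)$$ over $x_t\ge0$, $z_t$ free, $\gamma\in\mathbb R$, $\beta\ge 0$ and $\mu,\zeta,\psi\in\mathbb R^N_+$, subject to $A_tx_t+B_tz_t=b_t$, $z_t=x$, $G_{ij}^\top x_t+v_{ij}\le\gamma+(\mu_i-\zeta_i)/\sqrt{\hat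 w^i}$ for all $i,j$, and $\mu_i+\zeta_i=\psi_i+\beta/\sqrt N$ for all $i$. The upper bound problem $\mathrm{UB}_t(x,\xi_t)$ is the same program with the cut constraints replaced by $\overline q_i(x_t)\le\gamma+(\mu_i-\zeta_i)/\sqrt{\hat w^i}$ for all $i$, where $\overline q_i$ is the inner approximation built from points $\bar x^j$ with values $\overline V^{i}_j$, $$\overline q_i(x)=\min\Big\{\sum_j\theta_j\overline V^{i}_j+M_{t+1}\|y\|_1:\ \theta\ge0,\ \sum_j\theta_j=1,\ \sum_j\theta_j\bar x^j+y=x,\ y\in\mathbb R^{d_t}\Big\}.$$ For $t=T$ both approximations of $\hat Q_{T+1}$ are $0$. The penalties are such that, for $t=2,\dots,T$ and all $i$, $M_t$ is a Lipschitz constant in the $1$-norm of $\hat Q_t(\cdot,\xi_t^i)$ on the convex hull of the reachable states $x_{t-1}$. \emph{Algorithm (RDD-SDDP without termination test).} Start without cuts and points. In iteration $k=1,2,\dots$: (forward) put $\bar x_0^k=x_0$; for $t=1,\dots,T$ draw $\hat\xi_t$ from $\{\xi_t^i\}_{i\in[N]}$ with conditional probabilities $\hat w_{t-1}^i(\hat\xi_{t-1})$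 given everything computed and drawn before in this and earlier forward passes ($\hat\xi_1=\xi_1$), and let $\bar x_t^k$ be the $x_t$-part of an optimal solution of $\mathrm{LB}_t(\bar x_{t-1}^k,\hat\xi_t)$ with the cuts of the first $k-1$ iterations; in iteration $1$, where for $t<T$ there are no cuts, $\bar x_t^1$ is an arbitrary point of $\mathcal X_t(\bar x_{t-1}^1,\hat\xi_t)$. The choice of $\bar x_t^k$ may depend on the past, also randomly, but not on future draws. (Backward) for $t=T,\dots,2$ and all $i\in[N]$, using the cuts and points of stage $t+1$ of iterations $1,\dots,k$, compute the optimal value $\underline V_{t,k}^i$ of $\mathrm{LB}_t(\bar x_{t-1}^k,\xi_t^i)$, the part $\pi_{t,k}^i$ of an optimal dual solution that belongs to the constraint $z_t=\bar x_{t-1}^k$, and the optimal value $\overline V_{t,k}^i$ of $\mathrm{UB}_t(\bar x_{t-1}^k,\xi_t^i)$; add the cut $\ell\ge(\pi_{t,k}^i)^\top(x-\bar x_{t-1}^k)+\underline V_{t,k}^i$ and the point $\bar x_{t-1}^k$ with value $\overline V_{t,k}^i$ to the approximations of $\hat Q_t(\cdot,\xi_t^i)$. Write $\underline Q_{t,k}(x,\xi_t^i)$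 and $\overline Q_{t,k}(x,\xi_t^i)$ for the optimal values of $\mathrm{LB}_t(x,\xi_t^i)$ and $\mathrm{UB}_t(x,\xi_t^i)$ after iteration $k$; for $t=1$ and $x=x_0$ these are the bounds $LB$ and $UB$ of iteration $k$. Assume (B1) all candidates $\bar x_t^k$ that are obtained by solving $\mathrm{LB}_t$ come from optimal solutions that are primal basic feasible solutions (extreme points of the feasible polyhedron); (B2) all $\pi_{t,k}^i$ come from optimal dual solutions that are dual basic feasible solutions (extreme points of the dual feasible polyhedron). \emph{Conclusion.} With probability one there is a finite $K$ such that for all $k\ge K$: (i) $\bar x_1^k$ is an optimal solution of the first-stage problem $$\min_{x_1\in\mathcal X_1(x_0,\xi_1)} c_1^\top x_1+\max_{w\in\mathcal P_1^\lambda(\xi_1)}\sum_{j\in[N]}w_j\,\hat Q_2(x_1,\xi_2^j);$$ (ii) for all $k'\ge K$, $t\in\{1,\dots,T\}$ and $i\in[N]$, $$\underline Q_{t,k}(\bar x_{t-1}^{k'},\xi_t^i)=\hat Q_t(\bar x_{t-1}^{k'},\xi_t^i)=\overline Q_{t,k}(\bar x_{t-1}^{k'},\xi_t^i),$$ with all optimal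 values attained; in particular $LB$ and $UB$ equal the optimal value of the first-stage problem; (iii) for all $k'\ge K$, $t\in\{2,\dots,T\}$ and $i\in[N]$, the maximum of the cuts and the inner approximation $\overline q_i$ of $\hat Q_t(\cdot,\xi_t^i)$ after iteration $k$ also equal $\hat Q_t(\bar x_{t-1}^{k'},\xi_t^i)$ at $\bar x_{t-1}^{k'}$. -/

import Mathlib

open scoped Matrix

namespace RDDSDDP

noncomputable section

/-- A realization `ξ = (c, b, A, B)` of the parameters of one stage: `d₀` is the dimension of the
previous decision, `d₁` that of the current decision, `m` the number of equality constraints. -/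
structure Param (d₀ d₁ m : ℕ) where
  c : Fin d₁ → ℝ
  b : Fin m → ℝ
  A : Matrix (Fin m) (Fin d₁) ℝ
  B : Matrix (Fin m) (Fin d₀) ℝ

/-- The exponential kernel `exp (-‖(ξ - ξ') / h‖₂)`, with the Euclidean norm of the vector of all
entries of `(c, b, A, B)`. -/
def Param.kernel {d₀ d₁ m : ℕ} (h : ℝ) (p q : Param d₀ d₁ m) : ℝ :=
  Real.exp (-Real.sqrt
    ((∑ j, ((p.c j - q.c j) / h) ^ 2) + (∑ l, ((p.b l - q.b l) / h) ^ 2) +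
      (∑ l, ∑ j, ((p.A l j - q.A l j) / h) ^ 2) + (∑ l, ∑ j, ((p.B l j - q.B l j) / h) ^ 2)))

/-- The feasible region `𝒳(x, ξ) = {x' ≥ 0 : A x' + B x = b}`. -/
def Param.region {d₀ d₁ m : ℕ} (p : Param d₀ d₁ m) (x : Fin d₀ → ℝ) : Set (Fin d₁ → ℝ) :=
  {x' | 0 ≤ x' ∧ p.A *ᵥ x' + p.B *ᵥ x = p.b}

/-- The data of the discretized problem and of the algorithm.  The stages `1, …, T` are numbered
`0, …, T - 1` here: `ξ t i` is the `i`-th observed parameter of stage `t + 1`; the decision that is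
taken in that stage is `x_{t+1} ∈ ℝ^{d (t+1)}`, the state that enters it is `x_t ∈ ℝ^{d t}`.
`M t` is the penalty in the inner approximation of the cost-to-go functions of the state `x_t`. -/
structure Problem where
  T : ℕ
  N : ℕ
  T_pos : 0 < T
  N_pos : 0 < N
  d : ℕ → ℕ
  m : ℕ → ℕ
  x₀ : Fin (d 0) → ℝ
  ξ : (t : ℕ) → Fin N → Param (d t) (d (t + 1)) (m t)
  /-- the first-stage parameters are deterministic -/
  first_stage : ∀ i j, ξ 0 i = ξ 0 j
  h : ℝ
  h_pos : 0 < h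
  lam : ℝ
  lam_nonneg : 0 ≤ lam
  M : ℕ → ℝ

/-! ### The distributionally robust dynamic program -/

/-- The ambiguity set, as a set of weight vectors, with nominal weights `w` and radius `lam`. -/
def ambiguitySet {N : ℕ} (lam : ℝ) (w : Fin N → ℝ) : Set (Fin N → ℝ) :=
  {u | (∑ i, |(u i - w i) / √(w i)| ≤ √(N : ℝ) * lam) ∧ (∀ i, |(u i - w i) / √(w i)| ≤ lam) ∧
    (∑ i, u i = 1) ∧ ∀ i, 0 ≤ u i}

/-- The worst-case expectation of the loss vector `z` over the ambiguity set. -/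
def worstCase {N : ℕ} (lam : ℝ) (w z : Fin N → ℝ) : ℝ :=
  sSup ((fun u : Fin N → ℝ => ∑ i, u i * z i) '' ambiguitySet lam w)

namespace Problem

variable (P : Problem)

/-- The Nadaraya-Watson weight of the `i`-th observation, given `ξ t j`. -/
def weight (t : ℕ) (j i : Fin P.N) : ℝ :=
  (P.ξ t j).kernel P.h (P.ξ t i) / ∑ l, (P.ξ t j).kernel P.h (P.ξ t l)

/-- The states `x_t` from which the remaining `r` stages admit a feasible policy: the (common)
effective domain of the cost-to-go functions of the state `x_t`. -/
def effDomain : (r t : ℕ) → Set (Fin (P.d t) → ℝ)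
  | 0, _ => Set.univ
  | r + 1, t => {x | ∀ i, ∃ x' ∈ (P.ξ t i).region x, x' ∈ effDomain r (t + 1)}

/-- The robust cost-to-go function of the state `x_t = x` and the observation `i`, when `r` stages
remain: the minimum of `cᵀ x'` plus the worst-case expected cost-to-go.  Decisions `x'` at which the
following cost-to-go functions are `+∞` do not count. -/
def costToGoAux : (r t : ℕ) → (Fin (P.d t) → ℝ) → Fin P.N → ℝ
  | 0, _, _, _ => 0
  | r + 1, t, x, i =>
      sInf ((fun x' => (P.ξ t i).c ⬝ᵥ x' +
          worstCase P.lam (P.weight t i) (costToGoAux r (t + 1) x')) ''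
        ((P.ξ t i).region x ∩ P.effDomain r (t + 1)))

/-- The robust cost-to-go function of the state `x_t = x`, for the observation `i` of the
parameters of the stage that `x_t` enters; it vanishes for `t = T`. -/
def costToGo (t : ℕ) (x : Fin (P.d t) → ℝ) (i : Fin P.N) : ℝ :=
  P.costToGoAux (P.T - t) t x i

/-- The objective `cᵀ x' + max E[costToGo (x', ·)]` of the robust problem that chooses `x_{t+1}`
when `ξ t i` is observed. -/
def stageObjective (t : ℕ) (i : Fin P.N) (x' : Fin (P.d (t + 1)) → ℝ) : ℝ :=
  (P.ξ t i).c ⬝ᵥ x' + worstCase P.lam (P.weight t i) (P.costToGo (t + 1) x')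

/-- The values of `x_t` that feasible decisions can produce. -/
def reachable : (t : ℕ) → Set (Fin (P.d t) → ℝ)
  | 0 => {P.x₀}
  | t + 1 => {x' | ∃ x ∈ reachable t, ∃ i, x' ∈ (P.ξ t i).region x}

/-- Relatively complete recourse (for the observed parameters). -/
def RelativelyCompleteRecourse : Prop :=
  ∀ t < P.T, ∀ x ∈ P.reachable t, ∀ i,
    ((P.ξ t i).region x).Nonempty ∧ IsCompact ((P.ξ t i).region x)

/-- `M t` is a Lipschitz constant, for the `1`-norm, of the cost-to-go functions of `x_t` on the
convex hull of the reachable states. -/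
def PenaltyDominatesLipschitz : Prop :=
  ∀ t, 1 ≤ t → t < P.T → ∀ i, ∀ x ∈ convexHull ℝ (P.reachable t),
    ∀ y ∈ convexHull ℝ (P.reachable t),
      |P.costToGo t x i - P.costToGo t y i| ≤ P.M t * ∑ l, |x l - y l|

end Problem

/-! ### The lower and upper bound problems -/

/-- For each observation `i`, the cuts `ℓ ≥ slope i j ⬝ᵥ x + icpt i j`. -/
structure Cuts (N d : ℕ) where
  num : ℕ
  slope : Fin N → Fin num → Fin d → ℝ
  icpt : Fin N → Fin num → ℝ

/-- Points with, for each observation `i`, an upper bound of the cost-to-go there; `pen` is the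
penalty. -/
structure InnerPoints (N d : ℕ) where
  num : ℕ
  pt : Fin num → Fin d → ℝ
  val : Fin N → Fin num → ℝ
  pen : ℝ

/-- The outer approximation that is the zero function. -/
def Cuts.zero (N d : ℕ) : Cuts N d := ⟨1, fun _ _ => 0, fun _ _ => 0⟩

/-- An inner approximation that is the zero function: one point, value zero, no penalty. -/
def InnerPoints.zero (N d : ℕ) : InnerPoints N d := ⟨1, fun _ => 0, fun _ _ => 0, 0⟩

/-- The objective of the single-level linear programs. -/
def lpCost {N d₀ d₁ m : ℕ} (lam : ℝ) (p : Param d₀ d₁ m) (w : Fin N → ℝ) (x : Fin d₁ → ℝ)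
    (γ β : ℝ) (μ ζ ψ : Fin N → ℝ) : ℝ :=
  p.c ⬝ᵥ x + γ + lam * (β + ∑ i, ψ i) + ∑ i, √(w i) * (μ i - ζ i)

/-- Variables `(x, z, γ, β, μ, ζ, ψ)` of the lower bound problem. -/
abbrev PrimalVar (N d₀ d₁ : ℕ) : Type :=
  (Fin d₁ → ℝ) × (Fin d₀ → ℝ) × ℝ × ℝ × (Fin N → ℝ) × (Fin N → ℝ) × (Fin N → ℝ)

/-- Feasible set of the lower bound problem with fishing constraint `z = xprev`. -/
def lbFeasible {N d₀ d₁ m : ℕ} (p : Param d₀ d₁ m) (w : Fin N → ℝ) (C : Cuts N d₁)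
    (xprev : Fin d₀ → ℝ) : Set (PrimalVar N d₀ d₁) :=
  {v | match v with
    | (x, z, γ, β, μ, ζ, ψ) =>
      0 ≤ x ∧ 0 ≤ β ∧ 0 ≤ μ ∧ 0 ≤ ζ ∧ 0 ≤ ψ ∧
      p.A *ᵥ x + p.B *ᵥ z = p.b ∧ z = xprev ∧
      (∀ i j, C.slope i j ⬝ᵥ x + C.icpt i j ≤ γ + (μ i - ζ i) / √(w i)) ∧
      ∀ i, μ i + ζ i = ψ i + β / √(N : ℝ)}

/-- Objective of the lower bound problem. -/
def lbCost {N d₀ d₁ m : ℕ} (lam : ℝ) (p : Param d₀ d₁ m) (w : Fin N → ℝ)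
    (v : PrimalVar N d₀ d₁) : ℝ :=
  match v with
  | (x, _, γ, β, μ, ζ, ψ) => lpCost lam p w x γ β μ ζ ψ

/-- Optimal solutions of the lower bound problem. -/
def lbSolutions {N d₀ d₁ m : ℕ} (lam : ℝ) (p : Param d₀ d₁ m) (w : Fin N → ℝ) (C : Cuts N d₁)
    (xprev : Fin d₀ → ℝ) : Set (PrimalVar N d₀ d₁) :=
  {v | v ∈ lbFeasible p w C xprev ∧ IsMinOn (lbCost lam p w) (lbFeasible p w C xprev) v}

/-- The objective values that the lower bound problem can take; the optimal value, as a function of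
`xprev`, is the current lower bound of the cost-to-go function. -/
def lbValues {N d₀ d₁ m : ℕ} (lam : ℝ) (p : Param d₀ d₁ m) (w : Fin N → ℝ) (C : Cuts N d₁)
    (xprev : Fin d₀ → ℝ) : Set ℝ :=
  lbCost lam p w '' lbFeasible p w C xprev

/-- Variables `(ρ, π, y, r)` of the dual of the lower bound problem; `π` belongs to the fishing
constraint, `ρ` to `A x + B z = b`, `y` to the cuts and `r` to the last equations. -/
abbrev DualVar (N d₀ m n : ℕ) : Type :=
  (Fin m → ℝ) × (Fin d₀ → ℝ) × (Fin N → Fin n → ℝ) × (Fin N → ℝ)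

/-- Feasible set of the dual of the lower bound problem. -/
def lbDualFeasible {N d₀ d₁ m : ℕ} (lam : ℝ) (p : Param d₀ d₁ m) (w : Fin N → ℝ)
    (C : Cuts N d₁) : Set (DualVar N d₀ m C.num) :=
  {q | match q with
    | (ρ, π, y, r) =>
      (∀ i j, 0 ≤ y i j) ∧
      p.Aᵀ *ᵥ ρ ≤ p.c + ∑ i, ∑ j, y i j • C.slope i j ∧
      p.Bᵀ *ᵥ ρ + π = 0 ∧
      (∑ i, ∑ j, y i j = 1) ∧
      (∑ i, r i) / √(N : ℝ) ≤ lam ∧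
      (∀ i, (∑ j, y i j) / √(w i) ≤ √(w i) + r i) ∧
      (∀ i, √(w i) ≤ (∑ j, y i j) / √(w i) + r i) ∧
      ∀ i, r i ≤ lam}

/-- Objective of the dual of the lower bound problem. -/
def lbDualValue {N d₀ d₁ m : ℕ} (p : Param d₀ d₁ m) (C : Cuts N d₁) (xprev : Fin d₀ → ℝ)
    (q : DualVar N d₀ m C.num) : ℝ :=
  match q with
  | (ρ, π, y, _) => ρ ⬝ᵥ p.b + π ⬝ᵥ xprev + ∑ i, ∑ j, y i j * C.icpt i j

/-- Optimal solutions of the dual of the lower bound problem. -/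
def lbDualSolutions {N d₀ d₁ m : ℕ} (lam : ℝ) (p : Param d₀ d₁ m) (w : Fin N → ℝ)
    (C : Cuts N d₁) (xprev : Fin d₀ → ℝ) : Set (DualVar N d₀ m C.num) :=
  {q | q ∈ lbDualFeasible lam p w C ∧
    IsMaxOn (lbDualValue p C xprev) (lbDualFeasible lam p w C) q}

/-- The values `∑ θ_j val_j + pen ‖y‖₁` with `θ` in the simplex and `∑ θ_j pt_j + y = x`; their
minimum is the inner approximation at `x`, for the observation `i`. -/
def innerValues {N d : ℕ} (I : InnerPoints N d) (i : Fin N) (x : Fin d → ℝ) : Set ℝ :=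
  {v | ∃ (θ : Fin I.num → ℝ) (y : Fin d → ℝ), 0 ≤ θ ∧ ∑ j, θ j = 1 ∧
    (∑ j, θ j • I.pt j) + y = x ∧ v = ∑ j, θ j * I.val i j + I.pen * ∑ l, |y l|}

/-- The objective values that the upper bound problem can take; the optimal value, as a function of
`xprev`, is the current upper bound of the cost-to-go function. -/
def ubValues {N d₀ d₁ m : ℕ} (lam : ℝ) (p : Param d₀ d₁ m) (w : Fin N → ℝ) (I : InnerPoints N d₁)
    (xprev : Fin d₀ → ℝ) : Set ℝ :=
  {v | ∃ (x : Fin d₁ → ℝ) (γ β : ℝ) (μ ζ ψ : Fin N → ℝ) (q : Fin N → ℝ),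
    0 ≤ x ∧ 0 ≤ β ∧ 0 ≤ μ ∧ 0 ≤ ζ ∧ 0 ≤ ψ ∧
    p.A *ᵥ x + p.B *ᵥ xprev = p.b ∧
    (∀ i, q i ≤ γ + (μ i - ζ i) / √(w i)) ∧
    (∀ i, q i ∈ innerValues I i x) ∧
    (∀ i, μ i + ζ i = ψ i + β / √(N : ℝ)) ∧
    v = lpCost lam p w x γ β μ ζ ψ}

/-! ### The algorithm -/

/-- Everything that one infinite execution of the algorithm computes; the iterations are numbered
`0, 1, 2, …`.  In iteration `k`, `sample k t` is the index of the observation drawn for `ξ t`,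
`cand k t` is the candidate value of `x_t`, and, for the cost-to-go function of `x_t` at `cand k t`
and observation `i`, `vlow k t i`, `vup k t i` and `slope k t i` are the optimal values of the lower
and upper bound problems and the dual solution for the fishing constraint. -/
structure Run (P : Problem) where
  sample : ℕ → ℕ → Fin P.N
  cand : ℕ → (t : ℕ) → Fin (P.d t) → ℝ
  slope : ℕ → (t : ℕ) → Fin P.N → Fin (P.d t) → ℝ
  vlow : ℕ → ℕ → Fin P.N → ℝ
  vup : ℕ → ℕ → Fin P.N → ℝ

namespace Run

variable {P : Problem} (R : Run P)

/-- The cuts `ℓ ≥ slopeᵀ (x - cand) + vlow` for the state `x_t` generated by the first `n`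
iterations; at the end of the horizon the cost-to-go is zero. -/
def cuts (n t : ℕ) : Cuts P.N (P.d t) :=
  if t = P.T then Cuts.zero P.N (P.d t)
  else ⟨n, fun i j => R.slope j t i, fun i j => R.vlow j t i - R.slope j t i ⬝ᵥ R.cand j t⟩

/-- The inner approximation for the state `x_t` generated by the first `n` iterations. -/
def inner (n t : ℕ) : InnerPoints P.N (P.d t) :=
  if t = P.T then InnerPoints.zero P.N (P.d t)
  else ⟨n, fun j => R.cand j t, fun i j => R.vup j t i, P.M t⟩

/-- The execution follows the algorithm without its termination test.  While there are no cuts (the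
lower approximation is `-∞`) every feasible decision is optimal, so the candidates of the first
iteration are arbitrary feasible trial decisions, except in the last stage. -/
structure Follows : Prop where
  start : ∀ k, R.cand k 0 = P.x₀
  forward_feasible : ∀ k, ∀ t < P.T,
    R.cand k (t + 1) ∈ (P.ξ t (R.sample k t)).region (R.cand k t)
  forward_optimal : ∀ k, ∀ t < P.T, (0 < k ∨ t + 1 = P.T) →
    ∃ v ∈ lbSolutions P.lam (P.ξ t (R.sample k t)) (P.weight t (R.sample k t))
      (R.cuts k (t + 1)) (R.cand k t), v.1 = R.cand k (t + 1)
  backward_vlow : ∀ k t, 1 ≤ t → t < P.T → ∀ i,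
    IsLeast (lbValues P.lam (P.ξ t i) (P.weight t i) (R.cuts (k + 1) (t + 1)) (R.cand k t))
      (R.vlow k t i)
  backward_slope : ∀ k t, 1 ≤ t → t < P.T → ∀ i,
    ∃ q ∈ lbDualSolutions P.lam (P.ξ t i) (P.weight t i) (R.cuts (k + 1) (t + 1)) (R.cand k t),
      q.2.1 = R.slope k t i
  backward_vup : ∀ k t, 1 ≤ t → t < P.T → ∀ i,
    IsLeast (ubValues P.lam (P.ξ t i) (P.weight t i) (R.inner (k + 1) (t + 1)) (R.cand k t))
      (R.vup k t i)

/-- The candidates come from optimal solutions that are basic feasible solutions (extreme points of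
the feasible polyhedron) of the lower bound problems. -/
def PrimalBasic : Prop :=
  ∀ k, ∀ t < P.T, (0 < k ∨ t + 1 = P.T) →
    ∃ v ∈ lbSolutions P.lam (P.ξ t (R.sample k t)) (P.weight t (R.sample k t))
      (R.cuts k (t + 1)) (R.cand k t),
      v ∈ Set.extremePoints ℝ (lbFeasible (P.ξ t (R.sample k t)) (P.weight t (R.sample k t))
        (R.cuts k (t + 1)) (R.cand k t)) ∧
      v.1 = R.cand k (t + 1)

/-- The slopes of the cuts come from optimal dual solutions that are basic feasible solutions
(extreme points of the dual feasible polyhedron). -/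
def DualBasic : Prop :=
  ∀ k t, 1 ≤ t → t < P.T → ∀ i,
    ∃ q ∈ lbDualSolutions P.lam (P.ξ t i) (P.weight t i) (R.cuts (k + 1) (t + 1)) (R.cand k t),
      q ∈ Set.extremePoints ℝ
        (lbDualFeasible P.lam (P.ξ t i) (P.weight t i) (R.cuts (k + 1) (t + 1))) ∧
      q.2.1 = R.slope k t i

end Run

open MeasureTheory in
/-- The scenarios of a random execution are drawn from the recombining tree.  `ℱ (k, t)` is the
information available in iteration `k` immediately before the observation of `ξ t` is drawn: it
contains all earlier samples and the candidates up to `x_t` of iteration `k`.  Given this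
information, the next observation has the Nadaraya-Watson weights as its conditional
probabilities. -/
structure MonteCarlo (P : Problem) {Ω : Type*} [MeasurableSpace Ω] (μ : Measure Ω)
    (ℱ : Filtration (ℕ ×ₗ ℕ) ‹MeasurableSpace Ω›) (R : Ω → Run P) : Prop where
  sample_adapted : ∀ k, ∀ t < P.T,
    Measurable[ℱ (toLex (k, t + 1))] fun ω => (R ω).sample k t
  cand_adapted : ∀ k, ∀ t ≤ P.T,
    Measurable[ℱ (toLex (k, t))] fun ω => (R ω).cand k t
  conditional_law : ∀ k t, t + 1 < P.T → ∀ i,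
    μ[Set.indicator {ω | (R ω).sample k (t + 1) = i} (fun _ => (1 : ℝ)) | ℱ (toLex (k, t + 1))]
      =ᵐ[μ] fun ω => P.weight t ((R ω).sample k t) i

end

end RDDSDDP

/-! Basic solutions make the algorithm combinatorially finite. Backwards in the stages, every cut
ever generated lies in a finite set independent of the run, because dual extreme points over a
finite pool of cuts produce only finitely many new cuts (`exists_finite_cuts`). Forwards, primal
extreme points then leave finitely many candidates after the first iteration
(`exists_finite_candidates`). Hence from some iteration on every candidate is recurrent, that is,
visited infinitely often.

All weights are positive, so by the conditional Borel–Cantelli lemma almost surely every observation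
is drawn infinitely often at each recurrent state (`MonteCarlo.ae_frequently_sample`). The rest is
deterministic. Cuts are always valid lower bounds (weak duality), and inner approximations are
always upper bounds (convexity and the Lipschitz penalty). Suppose both are exact at the recurrent
values of `x_{t+1}`. A lower bound solution that lands on such a value is then truly optimal: the
problem never overestimates the optimum, and at this solution it does not underestimate the true
objective. So the bound problems become exact at recurrent `x_t` (`eventually_boundsExactAt`), and a
later visit records an exact cut and an exact point (`eventually_exactAt_of_bounds`). Backward
induction starts at the horizon, where everything is zero.

The linear programs arise by dualizing the maximum over the ambiguity set; all duality statements
come from Farkas' lemma through `exists_lagrange_multipliers`. -/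

namespace RDDSDDP

/-! ### Affine functions, Farkas' lemma and polyhedra -/

section Affine

variable {E : Type*} [AddCommGroup E] [Module ℝ E]

/-- `f` is an affine real function. -/
def IsAff (f : E → ℝ) : Prop :=
  ∀ (x y : E) (a b : ℝ), a + b = 1 → f (a • x + b • y) = a * f x + b * f y

namespace IsAff

variable {f g : E → ℝ}

theorem const (c : ℝ) : IsAff (fun _ : E => c) := fun _ _ a b h => by
  linear_combination (-c) * h

theorem add (hf : IsAff f) (hg : IsAff g) : IsAff fun v => f v + g v := fun x y a b h => by
  simp only [hf x y a b h, hg x y a b h]; ring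

theorem sub (hf : IsAff f) (hg : IsAff g) : IsAff fun v => f v - g v := fun x y a b h => by
  simp only [hf x y a b h, hg x y a b h]; ring

theorem neg (hf : IsAff f) : IsAff fun v => -f v := fun x y a b h => by
  simp only [hf x y a b h]; ring

theorem const_mul (c : ℝ) (hf : IsAff f) : IsAff fun v => c * f v := fun x y a b h => by
  simp only [hf x y a b h]; ring

theorem mul_const (hf : IsAff f) (c : ℝ) : IsAff fun v => f v * c := fun x y a b h => by
  simp only [hf x y a b h]; ring

theorem div_const (hf : IsAff f) (c : ℝ) : IsAff fun v => f v / c := fun x y a b h => by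
  simp only [hf x y a b h]; ring

theorem sum {ι : Type*} (s : Finset ι) {f : ι → E → ℝ} (hf : ∀ i, IsAff (f i)) :
    IsAff fun v => ∑ i ∈ s, f i v := fun x y a b h => by
  simp only [hf _ x y a b h, Finset.sum_add_distrib, Finset.mul_sum]

theorem dotProduct {n : Type*} [Fintype n] (c : n → ℝ) {F : E → n → ℝ}
    (hF : ∀ j, IsAff fun v => F v j) : IsAff fun v => c ⬝ᵥ F v :=
  sum _ fun j => (hF j).const_mul (c j)

theorem mulVec {m n : Type*} [Fintype n] (A : Matrix m n ℝ) {F : E → n → ℝ}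
    (hF : ∀ j, IsAff fun v => F v j) (l : m) : IsAff fun v => (A *ᵥ F v) l :=
  dotProduct (A l) hF

/-- The coefficients in `IsAff` may be negative, so combining with `0` gives homogeneity of `f - f
0`; additivity follows from the midpoint of `2x` and `2y`. -/
theorem linear_part (hf : IsAff f) : ∃ l : E →ₗ[ℝ] ℝ, ∀ v, f v = l v + f 0 := by
  have hs (c : ℝ) (x : E) : f (c • x) - f 0 = c * (f x - f 0) := by
    have := hf x 0 c (1 - c) (by ring)
    rw [smul_zero, add_zero] at this
    rw [this]; ring
  refine ⟨⟨⟨fun v => f v - f 0, fun x y => ?_⟩, fun c x => hs c x⟩, fun v => by simp⟩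
  have h1 := hf ((2 : ℝ) • x) ((2 : ℝ) • y) (1 / 2) (1 / 2) (by norm_num)
  have h2 := hs 2 x
  have h3 := hs 2 y
  rw [smul_smul, smul_smul] at h1
  norm_num at h1
  rw [h1]
  linarith

end IsAff

/-- Farkas' lemma for finitely many linear functionals. -/
theorem farkas (n : ℕ) (f : Fin n → E →ₗ[ℝ] ℝ) (g : E →ₗ[ℝ] ℝ)
    (h : ∀ v, (∀ i, f i v ≤ 0) → g v ≤ 0) :
    ∃ y : Fin n → ℝ, (∀ i, 0 ≤ y i) ∧ ∀ v, g v = ∑ i, y i * f i v := by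
  induction n generalizing g with
  | zero =>
    refine ⟨0, fun _ => le_rfl, fun v => ?_⟩
    have h1 := h v (fun i => i.elim0)
    have h2 := h (-v) (fun i => i.elim0)
    rw [map_neg] at h2
    simp only [Finset.univ_eq_empty, Finset.sum_empty]
    linarith
  | succ n ih =>
    -- If the last functional is superfluous, it gets multiplier zero.
    by_cases hc : ∀ v, (∀ i : Fin n, f i.castSucc v ≤ 0) → g v ≤ 0
    · obtain ⟨y, hy, hg⟩ := ih (fun i => f i.castSucc) g hc
      refine ⟨Fin.snoc y 0, fun i => ?_, fun v => ?_⟩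
      · refine Fin.lastCases ?_ (fun j => ?_) i <;> simp [hy]
      · rw [Fin.sum_univ_castSucc]; simp [hg]
    · push Not at hc
      obtain ⟨u, hu, hgu⟩ := hc
      have hl : 0 < f (Fin.last n) u := by
        by_contra hl
        refine absurd (h u fun i => ?_) (not_le.2 hgu)
        refine Fin.lastCases (not_lt.1 hl) (fun j => hu j) i
      -- Otherwise `u` violates only the last constraint. Projecting along `u` onto the kernel of
      -- the last functional reduces the claim to the other `n` functionals.
      set a := f (Fin.last n) u with ha
      obtain ⟨y, hy, hg⟩ := ih
        (fun i => f i.castSucc - (f i.castSucc u / a) • f (Fin.last n))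
        (g - (g u / a) • f (Fin.last n)) (fun v hv => by
          have := h (v - (f (Fin.last n) v / a) • u) (fun i => by
            refine Fin.lastCases ?_ (fun j => ?_) i
            · simp only [map_sub, map_smul, smul_eq_mul, ← ha]
              rw [div_mul_cancel₀ _ hl.ne']; simp
            · have := hv j
              simp only [map_sub, map_smul, smul_eq_mul, LinearMap.sub_apply,
                LinearMap.smul_apply] at this ⊢
              calc _ = _ := by ring
                _ ≤ 0 := this)
          simp only [map_sub, map_smul, smul_eq_mul, LinearMap.sub_apply,
            LinearMap.smul_apply] at this ⊢
          calc _ = _ := by ring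
            _ ≤ 0 := this)
      -- The last multiplier is forced by evaluating the identity at `u`; it is nonnegative since `g
      -- u > 0` and the other functionals are nonpositive there.
      refine ⟨Fin.snoc y ((g u - ∑ i, y i * f i.castSucc u) / a), fun i => ?_, fun v => ?_⟩
      · refine Fin.lastCases ?_ (fun j => ?_) i
        · rw [Fin.snoc_last]
          refine div_nonneg ?_ hl.le
          have : ∑ i, y i * f i.castSucc u ≤ 0 :=
            Finset.sum_nonpos fun i _ => mul_nonpos_of_nonneg_of_nonpos (hy i) (hu i)
          linarith
        · simpa using hy j
      · have := hg v
        simp only [LinearMap.sub_apply, LinearMap.smul_apply, smul_eq_mul, mul_sub,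
          Finset.sum_sub_distrib] at this
        rw [Fin.sum_univ_castSucc]
        simp only [Fin.snoc_castSucc, Fin.snoc_last]
        have h2 : ∑ i, y i * (f i.castSucc u / a * f (Fin.last n) v) =
            (∑ i, y i * f i.castSucc u) / a * f (Fin.last n) v := by
          rw [Finset.sum_div, Finset.sum_mul]
          exact Finset.sum_congr rfl fun i _ => by ring
        rw [h2] at this
        linear_combination this

/-- Homogenization: on `E × ℝ`, with the extra constraint `t ≥ 0`, the affine system becomes a cone
to which `farkas` applies. Setting `t = 1` returns the affine statement; the multiplier of `t ≥ 0`
is a nonnegative constant and is dropped. -/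
theorem exists_lagrange_multipliers_ineq {ι : Type*} [Fintype ι] {h : ι → E → ℝ} {g : E → ℝ}
    (hh : ∀ i, IsAff (h i)) (hg : IsAff g) {v₀ : E} (hv₀ : ∀ i, h i v₀ ≤ 0)
    (hmin : ∀ v, (∀ i, h i v ≤ 0) → 0 ≤ g v) :
    ∃ y : ι → ℝ, (∀ i, 0 ≤ y i) ∧ ∀ v, 0 ≤ g v + ∑ i, y i * h i v := by
  choose l hl using fun i => (hh i).linear_part
  obtain ⟨k, hk⟩ := hg.linear_part
  let e := Fintype.equivFin ι
  let F : Fin (Fintype.card ι + 1) → (E × ℝ) →ₗ[ℝ] ℝ := Fin.snoc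
    (fun i => (l (e.symm i)).comp (LinearMap.fst ℝ E ℝ) +
      (h (e.symm i) 0) • LinearMap.snd ℝ E ℝ) (-LinearMap.snd ℝ E ℝ)
  obtain ⟨y, hy, H⟩ := farkas _ F (-(k.comp (LinearMap.fst ℝ E ℝ) + g 0 • LinearMap.snd ℝ E ℝ))
    (by
      rintro ⟨v, t⟩ hv
      have h1 : ∀ i, l i v + h i 0 * t ≤ 0 := fun i => by
        have := hv (e i).castSucc
        simpa [F] using this
      have h2 : 0 ≤ t := by
        have := hv (Fin.last _)
        simpa [F] using this
      suffices 0 ≤ k v + g 0 * t by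
        simp only [LinearMap.neg_apply, LinearMap.add_apply, LinearMap.comp_apply,
          LinearMap.fst_apply, LinearMap.smul_apply, LinearMap.snd_apply, smul_eq_mul]
        linarith
      -- For `t = 0` the vector `v` is a recession direction, and a negative slope of `g` along it
      -- would make `g` negative far out on the ray from `v₀`. For `t > 0` rescaling gives the
      -- feasible point `t⁻¹ v`.
      rcases h2.eq_or_lt with rfl | h2
      · by_contra hneg
        simp only [mul_zero, add_zero, not_le] at hneg h1
        have h3 : ∀ s : ℝ, 0 ≤ s → 0 ≤ g v₀ + s * k v := fun s hs => by
          have := hmin (v₀ + s • v) fun i => by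
            rw [hl, map_add, map_smul, smul_eq_mul]
            have := hv₀ i
            rw [hl] at this
            nlinarith [mul_nonneg hs (neg_nonneg.2 (h1 i))]
          rw [hk, map_add, map_smul, smul_eq_mul] at this
          rw [hk v₀]; linarith
        have h4 := h3 ((g v₀ + 1) / -(k v))
          (div_nonneg (by have := hmin v₀ hv₀; linarith) (by linarith))
        rw [div_neg, neg_mul, div_mul_cancel₀ _ hneg.ne] at h4
        linarith
      · have := hmin (t⁻¹ • v) fun i => by
          rw [hl, map_smul, smul_eq_mul]
          have := mul_nonpos_of_nonneg_of_nonpos (inv_nonneg.2 h2.le) (h1 i)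
          rw [mul_add, mul_comm (h i 0), ← mul_assoc, inv_mul_cancel₀ h2.ne', one_mul] at this
          exact this
        rw [hk, map_smul, smul_eq_mul] at this
        have := mul_nonneg h2.le this
        rw [mul_add, ← mul_assoc, mul_inv_cancel₀ h2.ne', one_mul] at this
        linarith)
  refine ⟨fun i => y (e i).castSucc, fun i => hy _, fun v => ?_⟩
  have := H (v, 1)
  rw [Fin.sum_univ_castSucc] at this
  simp only [F, Fin.snoc_castSucc, Fin.snoc_last, LinearMap.neg_apply, LinearMap.add_apply,
    LinearMap.comp_apply, LinearMap.fst_apply, LinearMap.smul_apply, LinearMap.snd_apply,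
    smul_eq_mul, mul_one] at this
  have h3 : ∑ i, y (e i).castSucc * h i v =
      ∑ i, y i.castSucc * (l (e.symm i) v + h (e.symm i) 0) := by
    rw [← e.sum_comp]
    exact Finset.sum_congr rfl fun i _ => by rw [e.symm_apply_apply, hl i v]
  have h4 := hy (Fin.last _)
  rw [h3, hk v]
  linarith

/-- Lagrange multipliers for affine inequality and equality constraints. -/
theorem exists_lagrange_multipliers {ι κ : Type*} [Fintype ι] [Fintype κ] {h : ι → E → ℝ}
    {e : κ → E → ℝ} {g : E → ℝ} (hh : ∀ i, IsAff (h i)) (he : ∀ i, IsAff (e i)) (hg : IsAff g)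
    {v₀ : E} (hv₀ : ∀ i, h i v₀ ≤ 0) (hv₀' : ∀ i, e i v₀ = 0)
    (hmin : ∀ v, (∀ i, h i v ≤ 0) → (∀ i, e i v = 0) → 0 ≤ g v) :
    ∃ (y : ι → ℝ) (z : κ → ℝ), (∀ i, 0 ≤ y i) ∧
      ∀ v, 0 ≤ g v + ∑ i, y i * h i v + ∑ i, z i * e i v := by
  obtain ⟨y, hy, H⟩ := exists_lagrange_multipliers_ineq
    (h := Sum.elim h (Sum.elim e fun i v => -e i v)) (g := g) (v₀ := v₀)
    (by rintro (i | i | i); exacts [hh i, he i, (he i).neg]) hg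
    (by rintro (i | i | i); exacts [hv₀ i, (hv₀' i).le, by simp [hv₀' i]])
    (fun v hv => hmin v (fun i => hv (.inl i)) fun i =>
      le_antisymm (hv (.inr (.inl i))) (by simpa using hv (.inr (.inr i))))
  refine ⟨fun i => y (.inl i), fun i => y (.inr (.inl i)) - y (.inr (.inr i)),
    fun i => hy _, fun v => ?_⟩
  have := H v
  simp only [Fintype.sum_sum_type, Sum.elim_inl, Sum.elim_inr, mul_neg,
    Finset.sum_neg_distrib] at this
  simp only [sub_mul, Finset.sum_sub_distrib]
  linarith

/-- Reads dual constraints off a Lagrangian inequality: a single primal variable grows while the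
others stay fixed. -/
theorem coeff_nonneg {a b : ℝ} (h : ∀ t : ℝ, 0 ≤ t → 0 ≤ a + t * b) : 0 ≤ b := by
  by_contra hb
  push Not at hb
  have ha := h 0 le_rfl
  have := h ((a + 1) / -b) (div_nonneg (by linarith) (by linarith))
  rw [div_neg, neg_mul, div_mul_cancel₀ _ hb.ne] at this
  linarith

theorem coeff_eq_zero {a b : ℝ} (h : ∀ t : ℝ, 0 ≤ a + t * b) : b = 0 :=
  le_antisymm (neg_nonneg.1 (coeff_nonneg (a := a) fun t _ => by
    have := h (-t); linarith)) (coeff_nonneg fun t _ => h t)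

/-- A set described by finitely many affine inequalities. -/
def IsPoly (X : Set E) : Prop :=
  ∃ G : Set (E → ℝ), G.Finite ∧ (∀ g ∈ G, IsAff g) ∧ X = {v | ∀ g ∈ G, g v ≤ 0}

namespace IsPoly

theorem le {f g : E → ℝ} (hf : IsAff f) (hg : IsAff g) : IsPoly {v | f v ≤ g v} :=
  ⟨{fun v => f v - g v}, Set.finite_singleton _, by rintro _ rfl; exact hf.sub hg, by simp⟩

theorem and {p q : E → Prop} (hp : IsPoly {v | p v}) (hq : IsPoly {v | q v}) :
    IsPoly {v | p v ∧ q v} := by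
  obtain ⟨G, hG, ha, h⟩ := hp
  obtain ⟨G', hG', ha', h'⟩ := hq
  refine ⟨G ∪ G', hG.union hG', fun g hg => hg.elim (ha g) (ha' g), ?_⟩
  rw [Set.ofPred_and, h, h']
  ext v
  simp only [Set.mem_inter_iff, Set.mem_ofPred_eq, Set.mem_union]
  exact ⟨fun h g hg => hg.elim (h.1 g) (h.2 g), fun h => ⟨fun g hg => h g (.inl hg),
    fun g hg => h g (.inr hg)⟩⟩

theorem eq {f g : E → ℝ} (hf : IsAff f) (hg : IsAff g) : IsPoly {v | f v = g v} := by
  simpa only [le_antisymm_iff] using (le hf hg).and (le hg hf)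

theorem forall_mem {ι : Type*} {s : Set ι} (hs : s.Finite) {p : ι → E → Prop}
    (hp : ∀ i ∈ s, IsPoly {v | p i v}) : IsPoly {v | ∀ i ∈ s, p i v} := by
  choose! G hG ha h using hp
  refine ⟨⋃ i ∈ s, G i, hs.biUnion hG, fun g hg => ?_, ?_⟩
  · obtain ⟨i, hi, hgi⟩ := Set.mem_iUnion₂.1 hg
    exact ha i hi g hgi
  · ext v
    simp only [Set.mem_ofPred_eq, Set.mem_iUnion]
    refine ⟨fun hv g ⟨i, hi, hg⟩ => ?_, fun hv i hi => ?_⟩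
    · have : v ∈ {v | p i v} := hv i hi
      rw [h i hi] at this
      exact this g hg
    · change v ∈ {v | p i v}
      rw [h i hi]
      exact fun g hg => hv g ⟨i, hi, hg⟩

theorem all {ι : Type*} [Finite ι] {p : ι → E → Prop}
    (hp : ∀ i, IsPoly {v | p i v}) : IsPoly {v | ∀ i, p i v} := by
  simpa using forall_mem (s := Set.univ) Set.finite_univ fun i _ => hp i

theorem pi_eq {n : Type*} [Finite n] {f g : E → n → ℝ} (hf : ∀ j, IsAff fun v => f v j)
    (hg : ∀ j, IsAff fun v => g v j) : IsPoly {v | f v = g v} := by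
  simpa only [funext_iff] using all fun j => eq (hf j) (hg j)

theorem pi_le {n : Type*} [Finite n] {f g : E → n → ℝ} (hf : ∀ j, IsAff fun v => f v j)
    (hg : ∀ j, IsAff fun v => g v j) : IsPoly {v | f v ≤ g v} := by
  simpa only [Pi.le_def] using all fun j => le (hf j) (hg j)

/-- A polyhedron has finitely many extreme points: they are determined by their active
constraints. -/
theorem finite_extremePoints {X : Set E} (hX : IsPoly X) : (X.extremePoints ℝ).Finite := by
  obtain ⟨G, hG, ha, rfl⟩ := hX
  refine Set.Finite.of_finite_image (f := fun v => {g ∈ G | g v = 0})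
    (hG.finite_subsets.subset ?_) ?_
  · rintro _ ⟨v, -, rfl⟩
    exact Set.sep_subset _ _
  · intro v hv w hw hvw
    have hact : ∀ g ∈ G, g v = 0 → g w = 0 := fun g hg h0 => by
      have : g ∈ {g ∈ G | g v = 0} := ⟨hg, h0⟩
      simp only at hvw
      rw [hvw] at this
      exact this.2
    -- The point slightly beyond `v`, seen from `w`, stays feasible: constraints active at `v` are
    -- active at `w` too, and the others have slack. So `v` is interior to a segment starting at
    -- `w`, which forces `v = w`.
    have key : ∀ g ∈ G, ∀ᶠ ε in nhdsWithin (0 : ℝ) (Set.Ioi 0),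
        g ((1 + ε) • v + (-ε) • w) ≤ 0 := fun g hg => by
      have hform : ∀ ε : ℝ, g ((1 + ε) • v + (-ε) • w) = (1 + ε) * g v + (-ε) * g w :=
        fun ε => ha g hg v w _ _ (by ring)
      simp only [hform]
      rcases (hv.1 g hg).eq_or_lt with h0 | h0
      · simp [h0, hact g hg h0]
      · have hc : Continuous fun ε : ℝ => (1 + ε) * g v + (-ε) * g w := by fun_prop
        have := (hc.tendsto 0).eventually_lt_const (u := 0) (by simpa using h0)
        exact (this.filter_mono nhdsWithin_le_nhds).mono fun _ h => h.le
    have key2 := (Filter.eventually_all_finite hG).2 key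
    obtain ⟨ε, hε, hε0⟩ := (key2.and self_mem_nhdsWithin).exists
    have hε0 : 0 < ε := hε0
    have hseg : v ∈ openSegment ℝ w ((1 + ε) • v + (-ε) • w) := by
      have h1 : 0 < 1 + ε := by linarith
      refine ⟨ε / (1 + ε), 1 / (1 + ε), by positivity, by positivity, by field_simp; ring, ?_⟩
      rw [smul_add, smul_smul, smul_smul, one_div_mul_cancel h1.ne', one_smul]
      have : 1 / (1 + ε) * -ε = -(ε / (1 + ε)) := by ring
      rw [this, neg_smul]
      abel
    exact (hv.2 hw.1 hε hseg).symm

end IsPoly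

end Affine

/-! ### The worst-case expectation and its dual -/

section WorstCase

variable {N : ℕ} {lam : ℝ} {w : Fin N → ℝ}

theorem nominal_mem_ambiguitySet (hlam : 0 ≤ lam) (hw : ∀ i, 0 < w i) (hw1 : ∑ i, w i = 1) :
    w ∈ ambiguitySet lam w :=
  ⟨by simpa using mul_nonneg (Real.sqrt_nonneg _) hlam, fun _ => by simpa using hlam, hw1,
    fun i => (hw i).le⟩

/-- Every feasible point of the dual of the worst-case problem bounds the expectations. -/
theorem expectation_le_dual (hw : ∀ i, 0 < w i) {q u : Fin N → ℝ} {γ β : ℝ}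
    {μ ζ ψ : Fin N → ℝ} (hu : u ∈ ambiguitySet lam w) (hβ : 0 ≤ β) (hμ : 0 ≤ μ) (hζ : 0 ≤ ζ)
    (hψ : 0 ≤ ψ) (hq : ∀ i, q i ≤ γ + (μ i - ζ i) / √(w i))
    (he : ∀ i, μ i + ζ i = ψ i + β / √(N : ℝ)) :
    ∑ i, u i * q i ≤ γ + lam * (β + ∑ i, ψ i) + ∑ i, √(w i) * (μ i - ζ i) := by
  obtain ⟨h1, h2, h3, h4⟩ := hu
  -- With `r = (u i - w i) / √(w i)` one has `u i = w i + r √(w i)` and `r (μ i - ζ i) ≤ |r| (μ i +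
  -- ζ i) = |r| (ψ i + β / √N)`. The bound `|r| ≤ lam` serves the `ψ` term; the `β` term waits for
  -- the bound on the sum.
  have step (i : Fin N) : u i * q i ≤ u i * γ + √(w i) * (μ i - ζ i) + lam * ψ i +
      |(u i - w i) / √(w i)| * (β / √(N : ℝ)) := by
    have hs : 0 < √(w i) := Real.sqrt_pos.2 (hw i)
    set r := (u i - w i) / √(w i) with hr
    have hur : u i = √(w i) * √(w i) + r * √(w i) := by
      rw [hr, div_mul_cancel₀ _ hs.ne', Real.mul_self_sqrt (hw i).le]; ring
    have e1 : u i * ((μ i - ζ i) / √(w i)) = √(w i) * (μ i - ζ i) + r * (μ i - ζ i) := by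
      rw [hur]; field_simp
    have e2 : r * (μ i - ζ i) ≤ |r| * (μ i + ζ i) := by
      have := abs_le.1 (le_refl |r|)
      have hm := hμ i
      have hz := hζ i
      simp only [Pi.zero_apply] at hm hz
      nlinarith [mul_nonneg hm (sub_nonneg.2 (le_abs_self r)),
        mul_nonneg hz (sub_nonneg.2 (neg_le_abs r))]
    have e3 : |r| * ψ i ≤ lam * ψ i := mul_le_mul_of_nonneg_right (h2 i) (hψ i)
    have e4 := mul_le_mul_of_nonneg_left (hq i) (h4 i)
    rw [mul_add, e1] at e4
    rw [he i, mul_add] at e2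
    linarith
  have hN : 0 ≤ β / √(N : ℝ) := div_nonneg hβ (Real.sqrt_nonneg _)
  have hNβ : (√(N : ℝ) * lam) * (β / √(N : ℝ)) = lam * β := by
    rcases Nat.eq_zero_or_pos N with rfl | hN0
    · exact absurd h3 (by simp)
    · have : 0 < √(N : ℝ) := Real.sqrt_pos.2 (by exact_mod_cast hN0)
      field_simp
  have h5 := mul_le_mul_of_nonneg_right h1 hN
  rw [hNβ] at h5
  calc ∑ i, u i * q i ≤ ∑ i, (u i * γ + √(w i) * (μ i - ζ i) + lam * ψ i +
        |(u i - w i) / √(w i)| * (β / √(N : ℝ))) := Finset.sum_le_sum fun i _ => step i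
    _ = γ + ∑ i, √(w i) * (μ i - ζ i) + lam * ∑ i, ψ i +
        (∑ i, |(u i - w i) / √(w i)|) * (β / √(N : ℝ)) := by
      simp only [Finset.sum_add_distrib, ← Finset.sum_mul, ← Finset.mul_sum, h3, one_mul]
    _ ≤ _ := by linarith

/-- Makes the real `sSup` in `worstCase` a genuine supremum instead of the default value `0`. -/
theorem expectation_bddAbove (q : Fin N → ℝ) :
    BddAbove ((fun u : Fin N → ℝ => ∑ i, u i * q i) '' ambiguitySet lam w) := by
  refine ⟨∑ i, |q i|, ?_⟩
  rintro _ ⟨u, ⟨-, -, h3, h4⟩, rfl⟩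
  refine Finset.sum_le_sum fun i _ => ?_
  have : u i ≤ 1 := h3 ▸ Finset.single_le_sum (fun j _ => h4 j) (Finset.mem_univ i)
  calc u i * q i ≤ u i * |q i| := mul_le_mul_of_nonneg_left (le_abs_self _) (h4 i)
    _ ≤ 1 * |q i| := mul_le_mul_of_nonneg_right this (abs_nonneg _)
    _ = _ := one_mul _

theorem le_worstCase {q u : Fin N → ℝ} (hu : u ∈ ambiguitySet lam w) :
    ∑ i, u i * q i ≤ worstCase lam w q :=
  le_csSup (expectation_bddAbove q) ⟨u, hu, rfl⟩

theorem worstCase_le (hne : (ambiguitySet lam w).Nonempty) {q : Fin N → ℝ} {c : ℝ}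
    (h : ∀ u ∈ ambiguitySet lam w, ∑ i, u i * q i ≤ c) : worstCase lam w q ≤ c :=
  csSup_le (hne.image _) (by rintro _ ⟨u, hu, rfl⟩; exact h u hu)

theorem worstCase_mono (hne : (ambiguitySet lam w).Nonempty) {q q' : Fin N → ℝ}
    (h : ∀ i, q i ≤ q' i) : worstCase lam w q ≤ worstCase lam w q' :=
  worstCase_le hne fun _ hu => (Finset.sum_le_sum fun i _ =>
    mul_le_mul_of_nonneg_left (h i) (hu.2.2.2 i)).trans (le_worstCase hu)

theorem worstCase_convex (hne : (ambiguitySet lam w).Nonempty) (q q' : Fin N → ℝ) {a b : ℝ}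
    (ha : 0 ≤ a) (hb : 0 ≤ b) : worstCase lam w (fun i => a * q i + b * q' i) ≤
      a * worstCase lam w q + b * worstCase lam w q' :=
  worstCase_le hne fun u hu => by
    have h1 := mul_le_mul_of_nonneg_left (le_worstCase (q := q) hu) ha
    have h2 := mul_le_mul_of_nonneg_left (le_worstCase (q := q') hu) hb
    calc ∑ i, u i * (a * q i + b * q' i) = a * ∑ i, u i * q i + b * ∑ i, u i * q' i := by
          rw [Finset.mul_sum, Finset.mul_sum, ← Finset.sum_add_distrib]
          exact Finset.sum_congr rfl fun i _ => by ring
      _ ≤ _ := add_le_add h1 h2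

theorem worstCase_le_dual (hlam : 0 ≤ lam) (hw : ∀ i, 0 < w i) (hw1 : ∑ i, w i = 1)
    {q : Fin N → ℝ} {γ β : ℝ} {μ ζ ψ : Fin N → ℝ} (hβ : 0 ≤ β) (hμ : 0 ≤ μ) (hζ : 0 ≤ ζ)
    (hψ : 0 ≤ ψ) (hq : ∀ i, q i ≤ γ + (μ i - ζ i) / √(w i))
    (he : ∀ i, μ i + ζ i = ψ i + β / √(N : ℝ)) :
    worstCase lam w q ≤ γ + lam * (β + ∑ i, ψ i) + ∑ i, √(w i) * (μ i - ζ i) :=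
  worstCase_le ⟨w, nominal_mem_ambiguitySet hlam hw hw1⟩ fun _ hu =>
    expectation_le_dual hw hu hβ hμ hζ hψ hq he

/-- Strong duality for the worst-case expectation. -/
theorem exists_dual_eq_worstCase (hlam : 0 ≤ lam) (hw : ∀ i, 0 < w i) (hw1 : ∑ i, w i = 1)
    (q : Fin N → ℝ) : ∃ (γ β : ℝ) (μ ζ ψ : Fin N → ℝ), 0 ≤ β ∧ 0 ≤ μ ∧ 0 ≤ ζ ∧ 0 ≤ ψ ∧
      (∀ i, q i ≤ γ + (μ i - ζ i) / √(w i)) ∧ (∀ i, μ i + ζ i = ψ i + β / √(N : ℝ)) ∧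
      γ + lam * (β + ∑ i, ψ i) + ∑ i, √(w i) * (μ i - ζ i) = worstCase lam w q := by
  have hs (i : Fin N) : 0 < √(w i) := Real.sqrt_pos.2 (hw i)
  have hN0 : 0 < N := by
    rcases Nat.eq_zero_or_pos N with rfl | h
    · exact absurd hw1 (by simp)
    · exact h
  have hN : 0 < √(N : ℝ) := Real.sqrt_pos.2 (by exact_mod_cast hN0)
  -- the ambiguity set in the variables `(u, r)` with `|u - w| / √w ≤ r`
  let E := (Fin N → ℝ) × (Fin N → ℝ)
  let h : Fin N ⊕ Fin N ⊕ Fin N ⊕ Fin N ⊕ Unit → E → ℝ :=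
    Sum.elim (fun i v => -v.1 i) <| Sum.elim (fun i v => (v.1 i - w i) / √(w i) - v.2 i) <|
      Sum.elim (fun i v => -((v.1 i - w i) / √(w i)) - v.2 i) <|
      Sum.elim (fun i v => v.2 i - lam) fun _ v => ∑ i, v.2 i - √(N : ℝ) * lam
  let e : Unit → E → ℝ := fun _ v => ∑ i, v.1 i - 1
  have hu (i : Fin N) : IsAff fun v : E => v.1 i := fun x y a b _ => rfl
  have hr (i : Fin N) : IsAff fun v : E => v.2 i := fun x y a b _ => rfl
  obtain ⟨y, z, hy, H⟩ := exists_lagrange_multipliers (h := h) (e := e)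
    (g := fun v : E => worstCase lam w q - ∑ i, v.1 i * q i) (v₀ := (w, 0))
    (by
      rintro (i | i | i | i | i)
      · exact (hu i).neg
      · exact (((hu i).sub (.const _)).div_const _).sub (hr i)
      · exact (((hu i).sub (.const _)).div_const _).neg.sub (hr i)
      · exact (hr i).sub (.const _)
      · exact (IsAff.sum _ hr).sub (.const _))
    (fun _ => (IsAff.sum _ hu).sub (.const _))
    ((IsAff.const _).sub (IsAff.sum _ fun i => (hu i).mul_const _))
    (by
      have := mul_nonneg hN.le hlam
      rintro (i | i | i | i | i) <;> simp [h, hlam, (hw _).le, this])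
    (by simp [e, hw1])
    (fun v hv he => by
      have hvr (i : Fin N) : |(v.1 i - w i) / √(w i)| ≤ v.2 i :=
        abs_le'.2 ⟨sub_nonpos.1 (hv (.inr (.inl i))), sub_nonpos.1 (hv (.inr (.inr (.inl i))))⟩
      refine sub_nonneg.2 (le_worstCase ⟨?_, fun i => ?_, ?_, fun i => ?_⟩)
      · exact (Finset.sum_le_sum fun i _ => hvr i).trans
          (sub_nonpos.1 (hv (.inr (.inr (.inr (.inr ()))))))
      · exact (hvr i).trans (sub_nonpos.1 (hv (.inr (.inr (.inr (.inl i))))))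
      · exact sub_eq_zero.1 (he ())
      · exact neg_nonpos.1 (hv (.inl i)))
  set a := fun i => y (.inl i) with ha
  set μ := fun i => y (.inr (.inl i)) with hμ
  set ζ := fun i => y (.inr (.inr (.inl i))) with hζ
  set ψ := fun i => y (.inr (.inr (.inr (.inl i)))) with hψ
  set β := y (.inr (.inr (.inr (.inr ())))) with hβ
  have H' (u r : Fin N → ℝ) : 0 ≤ worstCase lam w q - ∑ i, u i * q i - ∑ i, a i * u i +
      ∑ i, μ i * ((u i - w i) / √(w i) - r i) + ∑ i, ζ i * (-((u i - w i) / √(w i)) - r i) +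
      ∑ i, ψ i * (r i - lam) + β * (∑ i, r i - √(N : ℝ) * lam) + z () * (∑ i, u i - 1) := by
    have := H (u, r)
    simp only [Fintype.sum_sum_type, h, e, Sum.elim_inl, Sum.elim_inr, Finset.univ_unique,
      Finset.sum_singleton, mul_neg, Finset.sum_neg_distrib] at this
    convert this using 1
    simp only [ha, hμ, hζ, hψ, hβ]
    ring
  -- The Lagrangian is affine in `(u, r)` and bounded below, so each of its coefficients vanishes.
  -- Perturbing around `u = w` removes the centred terms.
  have hru (i : Fin N) : μ i + ζ i = ψ i + β := by
    have : ψ i + β - (μ i + ζ i) = 0 := coeff_eq_zero (a := worstCase lam w q -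
        ∑ i, w i * q i - ∑ i, a i * w i - (∑ i, ψ i) * lam - β * (√(N : ℝ) * lam)) fun t => by
      have := H' w (Pi.single i t)
      simp only [sub_self, zero_div, neg_zero, zero_sub, mul_neg, Finset.sum_neg_distrib, hw1,
        mul_zero, add_zero, mul_sub, Finset.sum_sub_distrib, Pi.single_apply, mul_ite,
        Finset.sum_ite_eq', Finset.mem_univ, if_true, ← Finset.sum_mul] at this
      linarith
    linarith
  have hq (i : Fin N) : q i + a i = (μ i - ζ i) / √(w i) + z () := by
    have : (μ i - ζ i) / √(w i) + z () - (q i + a i) = 0 :=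
      coeff_eq_zero (a := worstCase lam w q - ∑ i, w i * q i - ∑ i, a i * w i -
        (∑ i, ψ i) * lam - β * (√(N : ℝ) * lam)) fun t => by
      have := H' (w + Pi.single i t) 0
      simp only [Pi.add_apply, add_sub_cancel_left, Pi.zero_apply, sub_zero, zero_sub, mul_neg,
        Finset.sum_neg_distrib, add_mul, mul_add, Finset.sum_add_distrib, hw1, Pi.single_apply,
        ite_mul, mul_ite, zero_mul, mul_zero, Finset.sum_ite_eq', Finset.mem_univ, if_true,
        ite_div, zero_div, ← Finset.sum_mul, Finset.sum_const_zero] at this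
      rw [mul_sub, mul_add, mul_div_assoc', mul_sub]
      have e : (t * μ i - t * ζ i) / √(w i) = μ i * (t / √(w i)) - ζ i * (t / √(w i)) := by ring
      rw [e]
      linarith
    linarith
  have hval : z () + lam * (√(N : ℝ) * β + ∑ i, ψ i) + ∑ i, √(w i) * (μ i - ζ i) ≤
      worstCase lam w q := by
    have := H' 0 0
    have hd (i : Fin N) : w i / √(w i) = √(w i) := by
      rw [div_eq_iff (hs i).ne', Real.mul_self_sqrt (hw i).le]
    simp only [Pi.zero_apply, zero_sub, neg_div, hd, zero_mul, mul_zero, Finset.sum_const_zero,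
      sub_zero, neg_neg, mul_neg, Finset.sum_neg_distrib, ← Finset.sum_mul] at this
    have e : ∑ i, √(w i) * (μ i - ζ i) = ∑ i, μ i * √(w i) - ∑ i, ζ i * √(w i) := by
      rw [← Finset.sum_sub_distrib]
      exact Finset.sum_congr rfl fun i _ => by ring
    rw [e]
    linarith
  -- The multiplier of the sum constraint is rescaled by `√N` to match the normalization in the
  -- linear program; the multipliers `a` of `u ≥ 0` become slack in the cut constraints.
  have h1 : 0 ≤ √(N : ℝ) * β := mul_nonneg hN.le (hy _)
  have h2 (i : Fin N) : q i ≤ z () + (μ i - ζ i) / √(w i) := by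
    have : 0 ≤ a i := hy _
    linarith [hq i]
  have h3 (i : Fin N) : μ i + ζ i = ψ i + √(N : ℝ) * β / √(N : ℝ) := by
    rw [mul_div_cancel_left₀ _ hN.ne', hru i]
  refine ⟨z (), √(N : ℝ) * β, μ, ζ, ψ, h1, fun i => hy _, fun i => hy _, fun i => hy _, h2, h3,
    hval.antisymm (worstCase_le_dual hlam hw hw1 h1 (fun i => hy _) (fun i => hy _)
      (fun i => hy _) h2 h3)⟩

end WorstCase

/-! ### Duality for the lower bound problem -/

section LowerBound

variable {N d₀ d₁ m : ℕ} {lam : ℝ} {p : Param d₀ d₁ m} {w : Fin N → ℝ}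

theorem sum_sum_smul_dotProduct {n : ℕ} (y : Fin N → Fin n → ℝ) (G : Fin N → Fin n → Fin d₁ → ℝ)
    (x : Fin d₁ → ℝ) :
    (∑ i, ∑ j, y i j • G i j) ⬝ᵥ x = ∑ i, ∑ j, y i j * (G i j ⬝ᵥ x) := by
  simp only [sum_dotProduct, smul_dotProduct, smul_eq_mul]

/-- Weak duality for the lower bound problem. -/
theorem lbDualValue_le_lbCost (hw : ∀ i, 0 < w i) {C : Cuts N d₁} {xprev : Fin d₀ → ℝ}
    {q : DualVar N d₀ m C.num} (hq : q ∈ lbDualFeasible lam p w C) {v : PrimalVar N d₀ d₁}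
    (hv : v ∈ lbFeasible p w C xprev) : lbDualValue p C xprev q ≤ lbCost lam p w v := by
  obtain ⟨ρ, π, y, r⟩ := q
  obtain ⟨x, z, γ, β, μ, ζ, ψ⟩ := v
  obtain ⟨hy, hA, hB, hy1, hr, h1, h2, hrl⟩ := hq
  obtain ⟨hx, hβ, hμ, hζ, hψ, hAB, rfl, hcut, he⟩ := hv
  -- The total multipliers of the cuts of each observation form a weight vector in the ambiguity
  -- set, with `r` dominating its scaled deviations. Weak duality thus reduces to
  -- `expectation_le_dual`.
  have hmem : (fun i => ∑ j, y i j) ∈ ambiguitySet lam w := by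
    have habs (i : Fin N) : |((∑ j, y i j) - w i) / √(w i)| ≤ r i := by
      rw [sub_div, Real.div_sqrt, abs_le]
      constructor <;> linarith [h1 i, h2 i]
    refine ⟨(Finset.sum_le_sum fun i _ => habs i).trans ?_, fun i => (habs i).trans (hrl i), hy1,
      fun i => Finset.sum_nonneg fun j _ => hy i j⟩
    have hN : 0 < √(N : ℝ) := by
      rcases Nat.eq_zero_or_pos N with rfl | h
      · simp at hy1
      · exact Real.sqrt_pos.2 (by exact_mod_cast h)
    rw [div_le_iff₀ hN] at hr
    linarith
  have hdual := expectation_le_dual (q := fun i => γ + (μ i - ζ i) / √(w i)) hw hmem hβ hμ hζ hψ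
    (fun i => le_rfl) he
  have hρ : ρ ⬝ᵥ p.b + π ⬝ᵥ z = (p.Aᵀ *ᵥ ρ) ⬝ᵥ x := by
    have : π = -(p.Bᵀ *ᵥ ρ) := eq_neg_of_add_eq_zero_right hB
    rw [← hAB, this, dotProduct_add, Matrix.dotProduct_mulVec, Matrix.dotProduct_mulVec,
      neg_dotProduct, Matrix.mulVec_transpose, Matrix.mulVec_transpose]
    ring
  have hAx : (p.Aᵀ *ᵥ ρ) ⬝ᵥ x ≤ (p.c + ∑ i, ∑ j, y i j • C.slope i j) ⬝ᵥ x :=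
    dotProduct_le_dotProduct_of_nonneg_right hA hx
  rw [add_dotProduct, sum_sum_smul_dotProduct] at hAx
  have hcuts : ∑ i, ∑ j, y i j * (C.slope i j ⬝ᵥ x) + ∑ i, ∑ j, y i j * C.icpt i j ≤
      ∑ i, (∑ j, y i j) * (γ + (μ i - ζ i) / √(w i)) := by
    rw [← Finset.sum_add_distrib]
    refine Finset.sum_le_sum fun i _ => ?_
    rw [← Finset.sum_add_distrib, Finset.sum_mul]
    refine Finset.sum_le_sum fun j _ => ?_
    rw [← mul_add]
    exact mul_le_mul_of_nonneg_left (hcut i j) (hy i j)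
  simp only [lbDualValue, lbCost, lpCost]
  linarith

/-- Strong duality for the lower bound problem. -/
theorem exists_lbDualFeasible {C : Cuts N d₁} {xprev : Fin d₀ → ℝ} {val : ℝ}
    (hval : IsLeast (lbValues lam p w C xprev) val) :
    ∃ q ∈ lbDualFeasible lam p w C, val ≤ lbDualValue p C xprev q := by
  obtain ⟨⟨⟨x₀, z₀, γ₀, β₀, μ₀, ζ₀, ψ₀⟩, hv₀, -⟩, hmin⟩ := hval
  obtain ⟨hx₀, hβ₀, hμ₀, hζ₀, hψ₀, hAB₀, rfl, hcut₀, he₀⟩ := hv₀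
  -- The variable `z` is eliminated through `z = xprev`; the multiplier of that equation is
  -- recovered at the end.
  let E := (Fin d₁ → ℝ) × ℝ × ℝ × (Fin N → ℝ) × (Fin N → ℝ) × (Fin N → ℝ)
  let h : Fin d₁ ⊕ Unit ⊕ Fin N ⊕ Fin N ⊕ Fin N ⊕ Fin N × Fin C.num → E → ℝ :=
    Sum.elim (fun j v => -v.1 j) <| Sum.elim (fun _ v => -v.2.2.1) <|
    Sum.elim (fun i v => -v.2.2.2.1 i) <| Sum.elim (fun i v => -v.2.2.2.2.1 i) <|
    Sum.elim (fun i v => -v.2.2.2.2.2 i) fun ij v =>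
      C.slope ij.1 ij.2 ⬝ᵥ v.1 + C.icpt ij.1 ij.2 -
        (v.2.1 + (v.2.2.2.1 ij.1 - v.2.2.2.2.1 ij.1) / √(w ij.1))
  let e : Fin m ⊕ Fin N → E → ℝ :=
    Sum.elim (fun l v => (p.A *ᵥ v.1) l + (p.B *ᵥ z₀) l - p.b l) fun i v =>
      v.2.2.2.1 i + v.2.2.2.2.1 i - (v.2.2.2.2.2 i + v.2.2.1 / √(N : ℝ))
  have ax (j) : IsAff fun v : E => v.1 j := fun _ _ _ _ _ => rfl
  have aγ : IsAff fun v : E => v.2.1 := fun _ _ _ _ _ => rfl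
  have aβ : IsAff fun v : E => v.2.2.1 := fun _ _ _ _ _ => rfl
  have aμ (i) : IsAff fun v : E => v.2.2.2.1 i := fun _ _ _ _ _ => rfl
  have aζ (i) : IsAff fun v : E => v.2.2.2.2.1 i := fun _ _ _ _ _ => rfl
  have aψ (i) : IsAff fun v : E => v.2.2.2.2.2 i := fun _ _ _ _ _ => rfl
  obtain ⟨Y, Z, hY, H⟩ := exists_lagrange_multipliers (h := h) (e := e)
    (g := fun v : E => lpCost lam p w v.1 v.2.1 v.2.2.1 v.2.2.2.1 v.2.2.2.2.1 v.2.2.2.2.2 - val)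
    (v₀ := (x₀, γ₀, β₀, μ₀, ζ₀, ψ₀))
    (by
      rintro (j | i | i | i | i | ij)
      · exact (ax j).neg
      · exact aβ.neg
      · exact (aμ i).neg
      · exact (aζ i).neg
      · exact (aψ i).neg
      · exact ((IsAff.dotProduct _ ax).add (.const _)).sub
          (aγ.add (((aμ _).sub (aζ _)).div_const _)))
    (by
      rintro (l | i)
      · exact ((IsAff.mulVec _ ax l).add (.const _)).sub (.const _)
      · exact ((aμ i).add (aζ i)).sub ((aψ i).add (aβ.div_const _)))
    (((((IsAff.dotProduct _ ax).add aγ).add ((aβ.add (IsAff.sum _ aψ)).const_mul _)).add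
      (IsAff.sum _ fun i => ((aμ i).sub (aζ i)).const_mul _)).sub (.const _))
    (by
      rintro (j | i | i | i | i | ij)
      · simpa [h] using hx₀ j
      · simpa [h] using hβ₀
      · simpa [h] using hμ₀ i
      · simpa [h] using hζ₀ i
      · simpa [h] using hψ₀ i
      · simpa [h] using hcut₀ ij.1 ij.2)
    (by
      rintro (l | i)
      · simpa [e, sub_eq_zero] using congrFun hAB₀ l
      · simpa [e, sub_eq_zero] using he₀ i)
    (by
      rintro ⟨x, γ, β, μ, ζ, ψ⟩ hv he
      exact sub_nonneg.2 (hmin ⟨(x, z₀, γ, β, μ, ζ, ψ),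
        ⟨fun j => neg_nonpos.1 (hv (.inl j)), neg_nonpos.1 (hv (.inr (.inl ()))),
        fun i => neg_nonpos.1 (hv (.inr (.inr (.inl i)))),
        fun i => neg_nonpos.1 (hv (.inr (.inr (.inr (.inl i))))),
        fun i => neg_nonpos.1 (hv (.inr (.inr (.inr (.inr (.inl i)))))),
        funext fun l => sub_eq_zero.1 (he (.inl l)), rfl,
        fun i j => sub_nonpos.1 (hv (.inr (.inr (.inr (.inr (.inr (i, j))))))),
        fun i => sub_eq_zero.1 (he (.inr i))⟩, rfl⟩))
  set y : Fin N → Fin C.num → ℝ := fun i j => Y (.inr (.inr (.inr (.inr (.inr (i, j)))))) with hy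
  set z : Fin m → ℝ := fun l => Z (.inl l) with hz
  set r : Fin N → ℝ := fun i => Z (.inr i) with hr
  -- The Lagrangian regrouped by primal variable, after dropping the nonnegative multipliers of the
  -- sign constraints. Its coefficients are exactly the dual constraints.
  have key (x : Fin d₁ → ℝ) (γ β : ℝ) (μ ζ ψ : Fin N → ℝ) (hx : 0 ≤ x) (hβ : 0 ≤ β) (hμ : 0 ≤ μ)
      (hζ : 0 ≤ ζ) (hψ : 0 ≤ ψ) :
      0 ≤ (z ⬝ᵥ (p.B *ᵥ z₀) - z ⬝ᵥ p.b + ∑ i, ∑ j, y i j * C.icpt i j - val) +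
        (p.c + ∑ i, ∑ j, y i j • C.slope i j + p.Aᵀ *ᵥ z) ⬝ᵥ x +
        γ * (1 - ∑ i, ∑ j, y i j) + β * (lam - (∑ i, r i) / √(N : ℝ)) +
        ∑ i, μ i * (√(w i) - (∑ j, y i j) / √(w i) + r i) +
        ∑ i, ζ i * ((∑ j, y i j) / √(w i) - √(w i) + r i) + ∑ i, ψ i * (lam - r i) := by
    have := H (x, γ, β, μ, ζ, ψ)
    simp only [Fintype.sum_sum_type, Fintype.sum_prod_type, h, e, Sum.elim_inl, Sum.elim_inr,
      Finset.univ_unique, Finset.sum_singleton, mul_neg, Finset.sum_neg_distrib] at this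
    have p1 : 0 ≤ ∑ j, Y (.inl j) * x j := Finset.sum_nonneg fun j _ => mul_nonneg (hY _) (hx j)
    have p2 : 0 ≤ Y (.inr (.inl default)) * β := mul_nonneg (hY _) hβ
    have p3 : 0 ≤ ∑ i, Y (.inr (.inr (.inl i))) * μ i :=
      Finset.sum_nonneg fun j _ => mul_nonneg (hY _) (hμ j)
    have p4 : 0 ≤ ∑ i, Y (.inr (.inr (.inr (.inl i)))) * ζ i :=
      Finset.sum_nonneg fun j _ => mul_nonneg (hY _) (hζ j)
    have p5 : 0 ≤ ∑ i, Y (.inr (.inr (.inr (.inr (.inl i))))) * ψ i :=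
      Finset.sum_nonneg fun j _ => mul_nonneg (hY _) (hψ j)
    have e1 : ∑ l, Z (.inl l) * ((p.A *ᵥ x) l + (p.B *ᵥ z₀) l - p.b l) =
        (p.Aᵀ *ᵥ z) ⬝ᵥ x + z ⬝ᵥ (p.B *ᵥ z₀) - z ⬝ᵥ p.b := by
      rw [Matrix.mulVec_transpose, ← Matrix.dotProduct_mulVec]
      simp only [dotProduct, ← Finset.sum_add_distrib, ← Finset.sum_sub_distrib]
      exact Finset.sum_congr rfl fun i _ => by ring
    have e2 : ∑ i, ∑ j, y i j * (C.slope i j ⬝ᵥ x + C.icpt i j - (γ + (μ i - ζ i) / √(w i))) =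
        (∑ i, ∑ j, y i j • C.slope i j) ⬝ᵥ x + ∑ i, ∑ j, y i j * C.icpt i j -
        γ * ∑ i, ∑ j, y i j - ∑ i, μ i * ((∑ j, y i j) / √(w i)) +
        ∑ i, ζ i * ((∑ j, y i j) / √(w i)) := by
      rw [sum_sum_smul_dotProduct, Finset.mul_sum]
      simp only [Finset.sum_div, Finset.mul_sum, ← Finset.sum_add_distrib,
        ← Finset.sum_sub_distrib]
      exact Finset.sum_congr rfl fun i _ => Finset.sum_congr rfl fun j _ => by ring
    have e3 : ∑ i, Z (.inr i) * (μ i + ζ i - (ψ i + β / √(N : ℝ))) =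
        ∑ i, μ i * r i + ∑ i, ζ i * r i - ∑ i, ψ i * r i - β * ((∑ i, r i) / √(N : ℝ)) := by
      rw [Finset.sum_div, Finset.mul_sum]
      simp only [← Finset.sum_add_distrib, ← Finset.sum_sub_distrib]
      exact Finset.sum_congr rfl fun i _ => by ring
    have e4 : ∑ i, √(w i) * (μ i - ζ i) = ∑ i, μ i * √(w i) - ∑ i, ζ i * √(w i) := by
      rw [← Finset.sum_sub_distrib]
      exact Finset.sum_congr rfl fun i _ => by ring
    have e5 : lam * ∑ i, ψ i = ∑ i, ψ i * lam := by
      rw [mul_comm, Finset.sum_mul]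
    rw [e1, e2, e3, lpCost, e4] at this
    simp only [mul_sub, mul_add, add_dotProduct, Finset.sum_add_distrib, Finset.sum_sub_distrib]
    linarith
  have cx (j : Fin d₁) : 0 ≤ (p.c + ∑ i, ∑ j, y i j • C.slope i j + p.Aᵀ *ᵥ z) j :=
    coeff_nonneg fun t ht => by
      have := key (Pi.single j t) 0 0 0 0 0 (by simpa using ht) le_rfl le_rfl le_rfl le_rfl
      simp only [dotProduct_single, zero_mul, Pi.zero_apply, Finset.sum_const_zero,
        add_zero] at this
      rwa [mul_comm] at this
  have cγ : 1 - ∑ i, ∑ j, y i j = 0 := coeff_eq_zero fun t => by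
    simpa using key 0 t 0 0 0 0 le_rfl le_rfl le_rfl le_rfl le_rfl
  have cβ : 0 ≤ lam - (∑ i, r i) / √(N : ℝ) := coeff_nonneg fun t ht => by
    simpa using key 0 0 t 0 0 0 le_rfl ht le_rfl le_rfl le_rfl
  have cμ (i : Fin N) : 0 ≤ √(w i) - (∑ j, y i j) / √(w i) + r i := coeff_nonneg fun t ht => by
    simpa [Pi.single_apply] using
      key 0 0 0 (Pi.single i t) 0 0 le_rfl le_rfl (by simpa using ht) le_rfl le_rfl
  have cζ (i : Fin N) : 0 ≤ (∑ j, y i j) / √(w i) - √(w i) + r i := coeff_nonneg fun t ht => by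
    simpa [Pi.single_apply] using
      key 0 0 0 0 (Pi.single i t) 0 le_rfl le_rfl le_rfl (by simpa using ht) le_rfl
  have cψ (i : Fin N) : 0 ≤ lam - r i := coeff_nonneg fun t ht => by
    simpa [Pi.single_apply] using
      key 0 0 0 0 0 (Pi.single i t) le_rfl le_rfl le_rfl le_rfl (by simpa using ht)
  have c0 := key 0 0 0 0 0 0 le_rfl le_rfl le_rfl le_rfl le_rfl
  simp only [dotProduct_zero, zero_mul, Pi.zero_apply, Finset.sum_const_zero, add_zero] at c0
  -- The dual sign convention is opposite to that of the Lagrangian, so `ρ = -z`; stationarity in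
  -- the eliminated variable then leaves `π = Bᵀ z`.
  refine ⟨(-z, p.Bᵀ *ᵥ z, y, r), ⟨fun i j => hY _, fun j => ?_, ?_, by linarith, by linarith,
    fun i => by linarith [cμ i], fun i => by linarith [cζ i], fun i => by linarith [cψ i]⟩, ?_⟩
  · have := cx j
    simp only [Pi.add_apply] at this
    simp only [Matrix.mulVec_neg, Pi.neg_apply, Pi.add_apply]
    linarith
  · simp [Matrix.mulVec_neg]
  · have : (p.Bᵀ *ᵥ z) ⬝ᵥ z₀ = z ⬝ᵥ (p.B *ᵥ z₀) := by
      rw [Matrix.mulVec_transpose, Matrix.dotProduct_mulVec]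
    simp only [lbDualValue, neg_dotProduct, this]
    linarith

/-- Absence of a duality gap identifies the recorded optimal value with the dual objective, hence
the added cut with the affine function of the dual solution. -/
theorem lbDualValue_eq_of_mem_lbDualSolutions (hw : ∀ i, 0 < w i) {C : Cuts N d₁}
    {xprev : Fin d₀ → ℝ} {val : ℝ} (hval : IsLeast (lbValues lam p w C xprev) val)
    {q : DualVar N d₀ m C.num} (hq : q ∈ lbDualSolutions lam p w C xprev) :
    lbDualValue p C xprev q = val := by
  obtain ⟨q', hq', hle⟩ := exists_lbDualFeasible hval
  obtain ⟨v, hv, rfl⟩ := hval.1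
  exact (lbDualValue_le_lbCost hw hq.1 hv).antisymm (hle.trans (hq.2 hq'))

end LowerBound

/-! ### The dynamic program -/

theorem abs_dotProduct_le {n : ℕ} (u x : Fin n → ℝ) : |u ⬝ᵥ x| ≤ (∑ j, |u j|) * ‖x‖ := by
  rw [Finset.sum_mul]
  refine (Finset.abs_sum_le_sum_abs _ _).trans (Finset.sum_le_sum fun j _ => ?_)
  rw [abs_mul]
  exact mul_le_mul_of_nonneg_left (norm_le_pi_norm x j) (abs_nonneg _)

/-- If one nonempty region is compact, all regions grow at most linearly. -/
theorem Param.exists_norm_le_of_mem_region {d₀ d₁ m : ℕ} (p : Param d₀ d₁ m) {x₀ : Fin d₀ → ℝ}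
    (hne : (p.region x₀).Nonempty) (hc : IsCompact (p.region x₀)) :
    ∃ K : ℝ, 0 ≤ K ∧ ∀ x, ∀ x' ∈ p.region x, ‖x'‖ ≤ K * (1 + ‖x‖) := by
  obtain ⟨y₀, hy₀, hAB⟩ := hne
  obtain ⟨R, hR⟩ := hc.isBounded.exists_norm_le
  -- Boundedness of one nonempty region means that `y ≥ 0`, `A y = 0` has only the zero solution. By
  -- duality some `ρ` satisfies `Aᵀ ρ ≥ 1` componentwise, so `∑ x' ≤ ρ ⬝ A x' = ρ ⬝ b - ρ ⬝ B x` for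
  -- every `x`.
  obtain ⟨Y, ρ, hY, H⟩ := exists_lagrange_multipliers (E := Fin d₁ → ℝ)
    (h := fun j y => -y j) (e := fun l y => (p.A *ᵥ y) l) (g := fun y => 0 - ∑ j, y j) (v₀ := 0)
    (fun j => IsAff.neg fun _ _ _ _ _ => rfl) (IsAff.mulVec _ fun j _ _ _ _ _ => rfl)
    ((IsAff.const 0).sub (IsAff.sum _ fun j _ _ _ _ _ => rfl)) (by simp) (by simp)
    (fun y hy hAy => by
      have hy (j) : 0 ≤ y j := neg_nonpos.1 (hy j)
      suffices ∀ j, y j ≤ 0 by simpa using Finset.sum_nonpos fun j _ => this j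
      intro j
      have := coeff_nonneg (a := R) (b := -y j) fun t ht => by
        have hmem : y₀ + t • y ∈ p.region x₀ := by
          refine ⟨fun l => add_nonneg (hy₀ l) (mul_nonneg ht (hy l)), ?_⟩
          have : p.A *ᵥ y = 0 := funext hAy
          rw [Matrix.mulVec_add, Matrix.mulVec_smul, this, smul_zero, add_zero, hAB]
        have h1 := (Real.le_norm_self _).trans ((norm_le_pi_norm _ j).trans (hR _ hmem))
        have h2 := hy₀ j
        simp only [Pi.add_apply, Pi.smul_apply, smul_eq_mul, Pi.zero_apply] at h1 h2
        linarith
      linarith)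
  set c := ∑ j, |(ρ ᵥ* p.B) j|
  have hc0 : 0 ≤ c := Finset.sum_nonneg fun _ _ => abs_nonneg _
  refine ⟨|ρ ⬝ᵥ p.b| + c, by positivity, fun x x' hx' => ?_⟩
  have h1 : ‖x'‖ ≤ ∑ j, x' j := by
    refine (pi_norm_le_iff_of_nonneg (Finset.sum_nonneg fun j _ => hx'.1 j)).2 fun j => ?_
    rw [Real.norm_of_nonneg (hx'.1 j)]
    exact Finset.single_le_sum (fun j _ => hx'.1 j) (Finset.mem_univ j)
  have h2 : ∑ j, x' j ≤ ρ ⬝ᵥ (p.A *ᵥ x') := by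
    have h3 : ∑ j, Y j * -x' j ≤ 0 := Finset.sum_nonpos fun j _ =>
      mul_nonpos_of_nonneg_of_nonpos (hY j) (neg_nonpos.2 (hx'.1 j))
    have h4 : ρ ⬝ᵥ (p.A *ᵥ x') = ∑ l, ρ l * (p.A *ᵥ x') l := rfl
    linarith [H x']
  have h3 : ρ ⬝ᵥ (p.A *ᵥ x') = ρ ⬝ᵥ p.b - (ρ ᵥ* p.B) ⬝ᵥ x := by
    rw [← hx'.2, dotProduct_add, ← Matrix.dotProduct_mulVec ρ p.B]; ring
  have h4 := (abs_le.1 (abs_dotProduct_le (ρ ᵥ* p.B) x)).1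
  have h5 := le_abs_self (ρ ⬝ᵥ p.b)
  have h6 := mul_nonneg (abs_nonneg (ρ ⬝ᵥ p.b)) (norm_nonneg x)
  rw [mul_add, add_mul]
  linarith

namespace Problem

variable (P : Problem)

theorem kernel_pos {t : ℕ} (j i : Fin P.N) : 0 < (P.ξ t j).kernel P.h (P.ξ t i) := Real.exp_pos _

theorem weight_pos (t : ℕ) (j i : Fin P.N) : 0 < P.weight t j i :=
  div_pos (P.kernel_pos j i) (Finset.sum_pos (fun l _ => P.kernel_pos j l) ⟨i, Finset.mem_univ _⟩)

theorem sum_weight (t : ℕ) (j : Fin P.N) : ∑ i, P.weight t j i = 1 := by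
  simp only [weight, ← Finset.sum_div]
  exact div_self (Finset.sum_pos (fun l _ => P.kernel_pos j l) ⟨j, Finset.mem_univ _⟩).ne'

theorem weight_mem_ambiguitySet (t : ℕ) (j : Fin P.N) :
    P.weight t j ∈ ambiguitySet P.lam (P.weight t j) :=
  nominal_mem_ambiguitySet P.lam_nonneg (P.weight_pos t j) (P.sum_weight t j)

theorem nonempty_ambiguitySet (t : ℕ) (j : Fin P.N) :
    (ambiguitySet P.lam (P.weight t j)).Nonempty := ⟨_, P.weight_mem_ambiguitySet t j⟩

variable {P}

theorem reachable_nonempty (h : P.RelativelyCompleteRecourse) {t : ℕ} (ht : t ≤ P.T) :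
    (P.reachable t).Nonempty := by
  induction t with
  | zero => exact ⟨P.x₀, rfl⟩
  | succ t ih =>
    obtain ⟨x, hx⟩ := ih (by omega)
    obtain ⟨x', hx'⟩ := (h t (by omega) x hx ⟨0, P.N_pos⟩).1
    exact ⟨x', x, hx, _, hx'⟩

/-- At reachable states the intersection with `effDomain` in `costToGoAux` therefore excludes no
decision. -/
theorem reachable_subset_effDomain (h : P.RelativelyCompleteRecourse) {r t : ℕ}
    (hrt : t + r = P.T) : P.reachable t ⊆ P.effDomain r t := by
  induction r generalizing t with
  | zero => exact fun _ _ => trivial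
  | succ r ih =>
    intro x hx i
    obtain ⟨x', hx'⟩ := (h t (by omega) x hx i).1
    exact ⟨x', hx', ih (by omega) ⟨x, hx, i, hx'⟩⟩

/-- Linear growth of the regions, uniformly in the observation. -/
theorem exists_norm_le_of_mem_region (h : P.RelativelyCompleteRecourse) {t : ℕ} (ht : t < P.T) :
    ∃ K : ℝ, 0 ≤ K ∧ ∀ i, ∀ x, ∀ x' ∈ (P.ξ t i).region x, ‖x'‖ ≤ K * (1 + ‖x‖) := by
  obtain ⟨x₀, hx₀⟩ := reachable_nonempty h ht.le
  choose K hK0 hK using fun i =>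
    (P.ξ t i).exists_norm_le_of_mem_region (h t ht x₀ hx₀ i).1 (h t ht x₀ hx₀ i).2
  refine ⟨∑ i, K i, Finset.sum_nonneg fun i _ => hK0 i, fun i x x' hx' => (hK i x x' hx').trans ?_⟩
  exact mul_le_mul_of_nonneg_right (Finset.single_le_sum (fun j _ => hK0 j) (Finset.mem_univ i))
    (by positivity)

/-- If the following cost-to-go functions are bounded below with linear growth, so are the
objective values. -/
theorem exists_lower_bound_step (h : P.RelativelyCompleteRecourse) {r t : ℕ} (ht : t < P.T) {C : ℝ}
    (hC0 : 0 ≤ C)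
    (hC : ∀ x ∈ P.effDomain r (t + 1), ∀ i, -(C * (1 + ‖x‖)) ≤ P.costToGoAux r (t + 1) x i) :
    ∃ C' : ℝ, 0 ≤ C' ∧ ∀ x i, ∀ x' ∈ (P.ξ t i).region x ∩ P.effDomain r (t + 1),
      -(C' * (1 + ‖x‖)) ≤ (P.ξ t i).c ⬝ᵥ x' +
        worstCase P.lam (P.weight t i) (P.costToGoAux r (t + 1) x') := by
  obtain ⟨K, hK0, hK⟩ := exists_norm_le_of_mem_region h ht
  set c := ∑ i, ∑ j, |(P.ξ t i).c j|
  have hc0 : 0 ≤ c := Finset.sum_nonneg fun i _ => Finset.sum_nonneg fun j _ => abs_nonneg _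
  refine ⟨c * K + C * (1 + K), by positivity, fun x i x' ⟨hx', hx'e⟩ => ?_⟩
  have h1 : |(P.ξ t i).c ⬝ᵥ x'| ≤ c * ‖x'‖ := (abs_dotProduct_le _ _).trans <|
    mul_le_mul_of_nonneg_right (Finset.single_le_sum (f := fun i => ∑ j, |(P.ξ t i).c j|)
      (fun i _ => Finset.sum_nonneg fun j _ => abs_nonneg _) (Finset.mem_univ i)) (norm_nonneg _)
  have h2 : -(C * (1 + ‖x'‖)) ≤
      worstCase P.lam (P.weight t i) (P.costToGoAux r (t + 1) x') := by
    -- The nominal weights already give the required lower bound.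
    refine le_trans ?_ (le_worstCase (P.weight_mem_ambiguitySet t i))
    calc -(C * (1 + ‖x'‖)) = ∑ j, P.weight t i j * -(C * (1 + ‖x'‖)) := by
          rw [← Finset.sum_mul, P.sum_weight, one_mul]
      _ ≤ _ := Finset.sum_le_sum fun j _ =>
          mul_le_mul_of_nonneg_left (hC x' hx'e j) (P.weight_pos t i j).le
  have h3 := hK i x x' hx'
  have h4 := mul_le_mul_of_nonneg_left h3 hc0
  have h5 := mul_le_mul_of_nonneg_left h3 hC0
  have h6 := mul_nonneg hC0 (norm_nonneg x)
  have h7 := (abs_le.1 h1).1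
  nlinarith

/-- The real `sInf` must be a genuine infimum even at unreachable states, such as convex
combinations of candidates. Linear growth is the invariant that survives the recursion, because the
regions grow linearly. -/
theorem exists_costToGoAux_lower_bound (h : P.RelativelyCompleteRecourse) {r t : ℕ}
    (hrt : t + r = P.T) : ∃ C : ℝ, 0 ≤ C ∧
      ∀ x ∈ P.effDomain r t, ∀ i, -(C * (1 + ‖x‖)) ≤ P.costToGoAux r t x i := by
  induction r generalizing t with
  | zero =>
    exact ⟨0, le_rfl, fun x _ i => by simp [costToGoAux]⟩
  | succ r ih =>
    obtain ⟨C, hC0, hC⟩ := ih (t := t + 1) (by omega)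
    obtain ⟨C', hC0', hC'⟩ := exists_lower_bound_step h (by omega) hC0 hC
    refine ⟨C', hC0', fun x hx i => ?_⟩
    have hne : ((P.ξ t i).region x ∩ P.effDomain r (t + 1)).Nonempty := hx i
    refine le_csInf (hne.image _) ?_
    rintro _ ⟨x', hx', rfl⟩
    exact hC' x i x' hx'

theorem bddBelow_objective (h : P.RelativelyCompleteRecourse) {r t : ℕ}
    (hrt : t + (r + 1) = P.T) (x : Fin (P.d t) → ℝ) (i : Fin P.N) :
    BddBelow ((fun x' => (P.ξ t i).c ⬝ᵥ x' +
      worstCase P.lam (P.weight t i) (P.costToGoAux r (t + 1) x')) ''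
        ((P.ξ t i).region x ∩ P.effDomain r (t + 1))) := by
  obtain ⟨C, hC0, hC⟩ := exists_costToGoAux_lower_bound h (r := r) (t := t + 1) (by omega)
  obtain ⟨C', hC0', hC'⟩ := exists_lower_bound_step h (by omega) hC0 hC
  refine ⟨-(C' * (1 + ‖x‖)), ?_⟩
  rintro _ ⟨x', hx', rfl⟩
  exact hC' x i x' hx'

theorem region_combo {d₀ d₁ m : ℕ} {p : Param d₀ d₁ m} {x y : Fin d₀ → ℝ} {x' y' : Fin d₁ → ℝ}
    (hx : x' ∈ p.region x) (hy : y' ∈ p.region y) {a b : ℝ} (ha : 0 ≤ a) (hb : 0 ≤ b)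
    (hab : a + b = 1) : a • x' + b • y' ∈ p.region (a • x + b • y) := by
  refine ⟨add_nonneg (smul_nonneg ha hx.1) (smul_nonneg hb hy.1), ?_⟩
  calc _ = a • (p.A *ᵥ x' + p.B *ᵥ x) + b • (p.A *ᵥ y' + p.B *ᵥ y) := by
        simp only [Matrix.mulVec_add, Matrix.mulVec_smul, smul_add]; abel
    _ = p.b := by rw [hx.2, hy.2, ← add_smul, hab, one_smul]

theorem convex_effDomain (r t : ℕ) : Convex ℝ (P.effDomain r t) := by
  induction r generalizing t with
  | zero => exact convex_univ
  | succ r ih =>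
    intro x hx y hy a b ha hb hab i
    obtain ⟨x', hx', hx'e⟩ := hx i
    obtain ⟨y', hy', hy'e⟩ := hy i
    exact ⟨_, region_combo hx' hy' ha hb hab, ih (t + 1) hx'e hy'e ha hb hab⟩

/-- Partial minimization of a jointly convex objective over a convex graph. Attainment of the
minimum is not available, so `ε`-optimal decisions are combined. -/
theorem convexOn_costToGoAux (h : P.RelativelyCompleteRecourse) {r t : ℕ}
    (hrt : t + r = P.T) (i : Fin P.N) :
    ConvexOn ℝ (P.effDomain r t) fun x => P.costToGoAux r t x i := by
  refine ⟨convex_effDomain r t, ?_⟩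
  induction r generalizing t i with
  | zero => intro x _ y _ a b _ _ _; simp [costToGoAux]
  | succ r ih =>
    intro x hx y hy a b ha hb hab
    refine le_of_forall_pos_le_add fun ε hε => ?_
    have hne (x) (hx : x ∈ P.effDomain (r + 1) t) :
        ((P.ξ t i).region x ∩ P.effDomain r (t + 1)).Nonempty := hx i
    obtain ⟨_, ⟨x', hx', rfl⟩, hxε⟩ :=
      exists_lt_of_csInf_lt ((hne x hx).image _) (lt_add_of_pos_right (P.costToGoAux (r + 1) t x i) hε)
    obtain ⟨_, ⟨y', hy', rfl⟩, hyε⟩ :=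
      exists_lt_of_csInf_lt ((hne y hy).image _) (lt_add_of_pos_right (P.costToGoAux (r + 1) t y i) hε)
    refine (csInf_le (bddBelow_objective h hrt _ i) ⟨a • x' + b • y',
      ⟨region_combo hx'.1 hy'.1 ha hb hab, convex_effDomain _ _ hx'.2 hy'.2 ha hb hab⟩,
      rfl⟩).trans ?_
    have hw := (worstCase_mono (P.nonempty_ambiguitySet t i) fun j =>
      ih (by omega) j hx'.2 hy'.2 ha hb hab).trans
      (worstCase_convex (P.nonempty_ambiguitySet t i) _ _ ha hb)
    simp only [dotProduct_add, dotProduct_smul, smul_eq_mul]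
    have h1 := mul_le_mul_of_nonneg_left hxε.le ha
    have h2 := mul_le_mul_of_nonneg_left hyε.le hb
    have h3 : a * ε + b * ε = ε := by rw [← add_mul, hab, one_mul]
    simp only [mul_add] at h1 h2
    linarith

theorem costToGo_horizon (x : Fin (P.d P.T) → ℝ) (i : Fin P.N) : P.costToGo P.T x i = 0 := by
  rw [costToGo, Nat.sub_self, costToGoAux]

theorem costToGo_eq_sInf {t : ℕ} (ht : t < P.T) (x : Fin (P.d t) → ℝ) (i : Fin P.N) :
    P.costToGo t x i = sInf (P.stageObjective t i ''
      ((P.ξ t i).region x ∩ P.effDomain (P.T - (t + 1)) (t + 1))) := by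
  rw [costToGo, show P.T - t = P.T - (t + 1) + 1 by omega, costToGoAux]
  rfl

theorem costToGo_le (h : P.RelativelyCompleteRecourse) {t : ℕ} (ht : t < P.T)
    {x : Fin (P.d t) → ℝ} (hx : x ∈ P.reachable t) {i : Fin P.N} {x' : Fin (P.d (t + 1)) → ℝ}
    (hx' : x' ∈ (P.ξ t i).region x) : P.costToGo t x i ≤ P.stageObjective t i x' := by
  rw [costToGo_eq_sInf ht]
  exact csInf_le (bddBelow_objective h (by omega) x i)
    ⟨x', ⟨hx', reachable_subset_effDomain h (by omega) ⟨x, hx, i, hx'⟩⟩, rfl⟩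

theorem le_costToGo (h : P.RelativelyCompleteRecourse) {t : ℕ} (ht : t < P.T)
    {x : Fin (P.d t) → ℝ} (hx : x ∈ P.reachable t) {i : Fin P.N} {c : ℝ}
    (hc : ∀ x' ∈ (P.ξ t i).region x, c ≤ P.stageObjective t i x') : c ≤ P.costToGo t x i := by
  rw [costToGo_eq_sInf ht]
  obtain ⟨x', hx'⟩ := (h t ht x hx i).1
  refine le_csInf (Set.Nonempty.image _
    ⟨x', hx', reachable_subset_effDomain h (by omega) ⟨x, hx, i, hx'⟩⟩) ?_
  rintro _ ⟨y, hy, rfl⟩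
  exact hc y hy.1

/-- Jensen's inequality; the combination need not be reachable, but it stays in the convex effective
domain. -/
theorem costToGo_sum_le (h : P.RelativelyCompleteRecourse) {t : ℕ} (ht : t ≤ P.T) (i : Fin P.N)
    {n : ℕ} {θ : Fin n → ℝ} {pt : Fin n → Fin (P.d t) → ℝ} (hθ : 0 ≤ θ) (hθ1 : ∑ j, θ j = 1)
    (hpt : ∀ j, pt j ∈ P.reachable t) :
    P.costToGo t (∑ j, θ j • pt j) i ≤ ∑ j, θ j * P.costToGo t (pt j) i :=
  (convexOn_costToGoAux h (by omega) i).map_sum_le (fun j _ => hθ j) hθ1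
    fun j _ => reachable_subset_effDomain h (by omega) (hpt j)

end Problem

/-! ### Finiteness of basic solutions -/

section Finiteness

variable {N d₀ d₁ m : ℕ} {lam : ℝ} {p : Param d₀ d₁ m} {w : Fin N → ℝ}

/-- The cuts of `C` are taken from the finite collection `S`. -/
def Cuts.CutsIn (C : Cuts N d₁) (S : Set ((Fin d₁ → ℝ) × ℝ)) : Prop :=
  ∀ i j, (C.slope i j, C.icpt i j) ∈ S

/-- The feasible set of the lower bound problem, for a set of pairs of an observation and a cut. -/
def lbPolyhedron (p : Param d₀ d₁ m) (w : Fin N → ℝ) (A : Set (Fin N × (Fin d₁ → ℝ) × ℝ))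
    (xprev : Fin d₀ → ℝ) : Set (PrimalVar N d₀ d₁) :=
  {v | 0 ≤ v.1 ∧ 0 ≤ v.2.2.2.1 ∧ 0 ≤ v.2.2.2.2.1 ∧ 0 ≤ v.2.2.2.2.2.1 ∧ 0 ≤ v.2.2.2.2.2.2 ∧
    p.A *ᵥ v.1 + p.B *ᵥ v.2.1 = p.b ∧ v.2.1 = xprev ∧
    (∀ a ∈ A, a.2.1 ⬝ᵥ v.1 + a.2.2 ≤
      v.2.2.1 + (v.2.2.2.2.1 a.1 - v.2.2.2.2.2.1 a.1) / √(w a.1)) ∧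
    ∀ i, v.2.2.2.2.1 i + v.2.2.2.2.2.1 i = v.2.2.2.2.2.2 i + v.2.2.2.1 / √(N : ℝ)}

/-- Order and repetition of cuts do not affect the primal polyhedron, so a finite pool of cuts
allows only finitely many polyhedra however many iterations have passed. -/
theorem lbFeasible_eq_lbPolyhedron (C : Cuts N d₁) (xprev : Fin d₀ → ℝ) :
    lbFeasible p w C xprev = lbPolyhedron p w
      (Set.range fun ij : Fin N × Fin C.num => (ij.1, C.slope ij.1 ij.2, C.icpt ij.1 ij.2))
      xprev := by
  ext ⟨x, z, γ, β, μ, ζ, ψ⟩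
  simp only [lbFeasible, lbPolyhedron, Set.mem_ofPred_eq, Set.forall_mem_range, Prod.forall]

theorem isPoly_lbPolyhedron {A : Set (Fin N × (Fin d₁ → ℝ) × ℝ)} (hA : A.Finite)
    (xprev : Fin d₀ → ℝ) : IsPoly (lbPolyhedron p w A xprev) := by
  have ax (j) : IsAff fun v : PrimalVar N d₀ d₁ => v.1 j := fun _ _ _ _ _ => rfl
  have az (j) : IsAff fun v : PrimalVar N d₀ d₁ => v.2.1 j := fun _ _ _ _ _ => rfl
  have aγ : IsAff fun v : PrimalVar N d₀ d₁ => v.2.2.1 := fun _ _ _ _ _ => rfl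
  have aβ : IsAff fun v : PrimalVar N d₀ d₁ => v.2.2.2.1 := fun _ _ _ _ _ => rfl
  have aμ (i) : IsAff fun v : PrimalVar N d₀ d₁ => v.2.2.2.2.1 i := fun _ _ _ _ _ => rfl
  have aζ (i) : IsAff fun v : PrimalVar N d₀ d₁ => v.2.2.2.2.2.1 i := fun _ _ _ _ _ => rfl
  have aψ (i) : IsAff fun v : PrimalVar N d₀ d₁ => v.2.2.2.2.2.2 i := fun _ _ _ _ _ => rfl
  refine .and (.pi_le (fun _ => .const 0) ax) <| .and (.le (.const 0) aβ) <|
    .and (.pi_le (fun _ => .const 0) aμ) <| .and (.pi_le (fun _ => .const 0) aζ) <|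
    .and (.pi_le (fun _ => .const 0) aψ) <|
    .and (.pi_eq (fun l => (IsAff.mulVec _ ax l).add (.mulVec _ az l)) fun _ => .const _) <|
    .and (.pi_eq az fun _ => .const _) <| .and (.forall_mem hA fun a _ => ?_) <|
    .all fun i => .eq ((aμ i).add (aζ i)) ((aψ i).add (aβ.div_const _))
  exact .le ((IsAff.dotProduct _ ax).add (.const _)) (aγ.add (((aμ _).sub (aζ _)).div_const _))

/-- Finitely many cuts give rise to finitely many basic feasible decisions. -/
theorem finite_basic_decisions (p : Param d₀ d₁ m) (w : Fin N → ℝ) (xprev : Fin d₀ → ℝ)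
    {S : Set ((Fin d₁ → ℝ) × ℝ)} (hS : S.Finite) :
    {x | ∃ C : Cuts N d₁, C.CutsIn S ∧
      ∃ v ∈ (lbFeasible p w C xprev).extremePoints ℝ, v.1 = x}.Finite := by
  have hU : (Set.univ ×ˢ S : Set (Fin N × (Fin d₁ → ℝ) × ℝ)).Finite := Set.finite_univ.prod hS
  refine (hU.finite_subsets.biUnion (t := fun A =>
    Prod.fst '' (lbPolyhedron p w A xprev).extremePoints ℝ) fun A hA =>
      (isPoly_lbPolyhedron (hU.subset hA) xprev).finite_extremePoints.image _).subset ?_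
  rintro _ ⟨C, hC, v, hv, rfl⟩
  rw [lbFeasible_eq_lbPolyhedron] at hv
  refine Set.mem_biUnion ?_ ⟨v, hv, rfl⟩
  rintro _ ⟨ij, rfl⟩
  exact ⟨trivial, hC _ _⟩

theorem isPoly_lbDualFeasible (C : Cuts N d₁) : IsPoly (lbDualFeasible lam p w C) := by
  let E := DualVar N d₀ m C.num
  have aρ (l) : IsAff fun v : E => v.1 l := fun _ _ _ _ _ => rfl
  have aπ (l) : IsAff fun v : E => v.2.1 l := fun _ _ _ _ _ => rfl
  have ay (i j) : IsAff fun v : E => v.2.2.1 i j := fun _ _ _ _ _ => rfl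
  have ar (i) : IsAff fun v : E => v.2.2.2 i := fun _ _ _ _ _ => rfl
  have ays (i) : IsAff fun v : E => ∑ j, v.2.2.1 i j := .sum _ (ay i)
  have hset : lbDualFeasible lam p w C = {v : E | (∀ i j, 0 ≤ v.2.2.1 i j) ∧
      p.Aᵀ *ᵥ v.1 ≤ p.c + ∑ i, ∑ j, v.2.2.1 i j • C.slope i j ∧
      p.Bᵀ *ᵥ v.1 + v.2.1 = 0 ∧ (∑ i, ∑ j, v.2.2.1 i j = 1) ∧
      (∑ i, v.2.2.2 i) / √(N : ℝ) ≤ lam ∧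
      (∀ i, (∑ j, v.2.2.1 i j) / √(w i) ≤ √(w i) + v.2.2.2 i) ∧
      (∀ i, √(w i) ≤ (∑ j, v.2.2.1 i j) / √(w i) + v.2.2.2 i) ∧
      ∀ i, v.2.2.2 i ≤ lam} := by
    ext ⟨ρ, π, y, r⟩
    rfl
  rw [hset]
  refine .and (.all fun i => .all fun j => .le (.const 0) (ay i j)) <|
    .and (.pi_le (IsAff.mulVec _ aρ) fun l => ?_) <|
    .and (.pi_eq (fun l => (IsAff.mulVec _ aρ l).add (aπ l)) fun _ => .const _) <|
    .and (.eq (.sum _ ays) (.const _)) <| .and (.le ((IsAff.sum _ ar).div_const _) (.const _)) <|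
    .and (.all fun i => .le ((ays i).div_const _) (.add (.const _) (ar i))) <|
    .and (.all fun i => .le (.const _) (((ays i).div_const _).add (ar i))) <|
    .all fun i => .le (ar i) (.const _)
  simp only [Pi.add_apply, Finset.sum_apply, Pi.smul_apply, smul_eq_mul]
  exact (IsAff.const _).add (.sum _ fun i => .sum _ fun j => (ay i j).mul_const _)

/-! ### Merging repeated cuts in the dual polyhedron -/

section Merge

variable {C C' : Cuts N d₁} (φ : Fin N → Fin C.num → Fin C'.num)

/-- Merging of the dual variables of equal cuts. -/
def mergeDual (q : DualVar N d₀ m C.num) : DualVar N d₀ m C'.num :=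
  (q.1, q.2.1, fun i s => ∑ j with φ i j = s, q.2.2.1 i j, q.2.2.2)

theorem sum_merge {M : Type*} [AddCommMonoid M] [Module ℝ M] {n n' : ℕ} (φ : Fin n → Fin n')
    (y : Fin n → ℝ) (F : Fin n' → M) :
    ∑ s, (∑ j with φ j = s, y j) • F s = ∑ j, y j • F (φ j) := by
  rw [← Finset.sum_fiberwise_of_maps_to (s := Finset.univ) (t := Finset.univ) (g := φ)
    (fun _ _ => Finset.mem_univ _)]
  refine Finset.sum_congr rfl fun s _ => ?_
  rw [Finset.sum_smul]
  refine Finset.sum_congr rfl fun j hj => ?_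
  rw [(Finset.mem_filter.1 hj).2]

theorem sum_merge_one {n n' : ℕ} (φ : Fin n → Fin n') (y : Fin n → ℝ) :
    ∑ s, (∑ j with φ j = s, y j) = ∑ j, y j := by
  simpa using sum_merge φ y fun _ => (1 : ℝ)

variable {φ}

/-- The constraints see `y` only through its row sums and the weighted sum of slopes, which merging
preserves. Only the signs of the individual entries are lost. -/
theorem mem_lbDualFeasible_iff_merge (hφ : ∀ i j, C.slope i j = C'.slope i (φ i j))
    (q : DualVar N d₀ m C.num) : q ∈ lbDualFeasible lam p w C ↔
      (∀ i j, 0 ≤ q.2.2.1 i j) ∧ mergeDual φ q ∈ lbDualFeasible lam p w C' := by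
  obtain ⟨ρ, π, y, r⟩ := q
  simp only [lbDualFeasible, mergeDual, Set.mem_ofPred_eq, sum_merge, sum_merge_one, ← hφ]
  refine ⟨fun h => ⟨h.1, fun i s => Finset.sum_nonneg fun j _ => h.1 i j, h.2⟩,
    fun h => ⟨h.1, h.2.2⟩⟩

/-- The dimension of the dual polyhedron grows with the number of cuts, so its extreme points are
transported to a polyhedron of fixed dimension. A segment through the merged point lifts to a
segment through `q`, and extremality of `q` collapses it. -/
theorem mergeDual_mem_extremePoints (hφ : ∀ i j, C.slope i j = C'.slope i (φ i j))
    {q : DualVar N d₀ m C.num} (hq : q ∈ (lbDualFeasible lam p w C).extremePoints ℝ) :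
    mergeDual φ q ∈ (lbDualFeasible lam p w C').extremePoints ℝ := by
  have hq0 := (mem_lbDualFeasible_iff_merge hφ q).1 hq.1
  refine ⟨hq0.2, fun q₁ hq₁ q₂ hq₂ ⟨a, b, ha, hb, hab, hseg⟩ => ?_⟩
  set Y := (mergeDual φ q).2.2.1 with hY
  have hYi (i s) : Y i s = a * q₁.2.2.1 i s + b * q₂.2.2.1 i s := by
    rw [hY, ← hseg]; rfl
  -- split a merged multiplier in the proportions of `q`
  let split (q' : DualVar N d₀ m C'.num) : DualVar N d₀ m C.num :=
    (q'.1, q'.2.1, fun i j => q'.2.2.1 i (φ i j) * (q.2.2.1 i j / Y i (φ i j)), q'.2.2.2)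
  have hYsum (i s) : Y i s = ∑ j with φ i j = s, q.2.2.1 i j := rfl
  have hY0 (i s) : 0 ≤ Y i s := by
    rw [hYsum]
    exact Finset.sum_nonneg fun j _ => hq0.1 i j
  -- Where `Y` vanishes the proportions are undefined and division returns `0`; `h0` makes this the
  -- correct value.
  have merge_split (q' : DualVar N d₀ m C'.num) (h0 : ∀ i s, Y i s = 0 → q'.2.2.1 i s = 0) :
      mergeDual φ (split q') = q' := by
    refine Prod.ext rfl (Prod.ext rfl (Prod.ext (funext fun i => funext fun s => ?_) rfl))
    change ∑ j with φ i j = s, q'.2.2.1 i (φ i j) * (q.2.2.1 i j / Y i (φ i j)) = q'.2.2.1 i s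
    rw [Finset.sum_congr rfl (g := fun j => q'.2.2.1 i s / Y i s * q.2.2.1 i j) fun j hj => by
      rw [(Finset.mem_filter.1 hj).2]; ring, ← Finset.mul_sum]
    change _ * Y i s = _
    by_cases h : Y i s = 0
    · rw [h, mul_zero, h0 i s h]
    · exact div_mul_cancel₀ _ h
  have nonneg (q' : DualVar N d₀ m C'.num) (h : q' ∈ lbDualFeasible lam p w C') (i s) :
      0 ≤ q'.2.2.1 i s := h.1 i s
  have split_mem (q' : DualVar N d₀ m C'.num) (h : q' ∈ lbDualFeasible lam p w C')
      (h0 : ∀ i s, Y i s = 0 → q'.2.2.1 i s = 0) : split q' ∈ lbDualFeasible lam p w C := by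
    rw [mem_lbDualFeasible_iff_merge hφ, merge_split q' h0]
    exact ⟨fun i j => mul_nonneg (nonneg q' h _ _) (div_nonneg (hq0.1 i j) (hY0 _ _)), h⟩
  have z₁ (i s) (h : Y i s = 0) : q₁.2.2.1 i s = 0 := by
    have := mul_nonneg hb.le (nonneg q₂ hq₂ i s)
    have := mul_nonneg ha.le (nonneg q₁ hq₁ i s)
    exact (mul_eq_zero.1 (by linarith [hYi i s] : a * q₁.2.2.1 i s = 0)).resolve_left ha.ne'
  have z₂ (i s) (h : Y i s = 0) : q₂.2.2.1 i s = 0 := by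
    have := mul_nonneg hb.le (nonneg q₂ hq₂ i s)
    have := mul_nonneg ha.le (nonneg q₁ hq₁ i s)
    exact (mul_eq_zero.1 (by linarith [hYi i s] : b * q₂.2.2.1 i s = 0)).resolve_left hb.ne'
  have hcombo : a • split q₁ + b • split q₂ = q := by
    have e1 : a • q₁.1 + b • q₂.1 = q.1 := congrArg Prod.fst hseg
    have e2 : a • q₁.2.1 + b • q₂.2.1 = q.2.1 := congrArg (fun v => v.2.1) hseg
    have e3 : a • q₁.2.2.2 + b • q₂.2.2.2 = q.2.2.2 := congrArg (fun v => v.2.2.2) hseg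
    refine Prod.ext e1 (Prod.ext e2 (Prod.ext (funext fun i => funext fun j => ?_) e3))
    change a * (q₁.2.2.1 i (φ i j) * (q.2.2.1 i j / Y i (φ i j))) +
      b * (q₂.2.2.1 i (φ i j) * (q.2.2.1 i j / Y i (φ i j))) = q.2.2.1 i j
    rw [← mul_assoc, ← mul_assoc, ← add_mul, ← hYi]
    by_cases h : Y i (φ i j) = 0
    · have hz := h
      rw [hYsum] at hz
      have : q.2.2.1 i j = 0 := (Finset.sum_eq_zero_iff_of_nonneg fun j _ => hq0.1 i j).1 hz j
        (Finset.mem_filter.2 ⟨Finset.mem_univ _, rfl⟩)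
      rw [h, this, zero_mul]
    · exact mul_div_cancel₀ _ h
  have := hq.2 (split_mem q₁ hq₁ z₁) (split_mem q₂ hq₂ z₂) ⟨a, b, ha, hb, hab, hcombo⟩
  rw [← merge_split q₁ z₁, this]

end Merge

/-- The cut (slope and intercept) that a dual feasible solution generates. -/
def dualCut (p : Param d₀ d₁ m) (C : Cuts N d₁) (q : DualVar N d₀ m C.num) : (Fin d₀ → ℝ) × ℝ :=
  (q.2.1, q.1 ⬝ᵥ p.b + ∑ i, ∑ j, q.2.2.1 i j * C.icpt i j)

theorem lbDualValue_eq_dualCut (C : Cuts N d₁) (q : DualVar N d₀ m C.num) (x : Fin d₀ → ℝ) :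
    lbDualValue p C x q = (dualCut p C q).1 ⬝ᵥ x + (dualCut p C q).2 := by
  simp only [lbDualValue, dualCut]
  ring

/-- Finitely many cuts give rise to finitely many new cuts by dual basic feasible solutions. -/
theorem finite_basic_cuts (lam : ℝ) (p : Param d₀ d₁ m) (w : Fin N → ℝ)
    {S : Set ((Fin d₁ → ℝ) × ℝ)} (hS : S.Finite) :
    {c | ∃ C : Cuts N d₁, C.CutsIn S ∧
      ∃ q ∈ (lbDualFeasible lam p w C).extremePoints ℝ, dualCut p C q = c}.Finite := by
  -- `C'` offers every cut of the pool exactly once to every observation; its dual polyhedron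
  -- depends on `S` alone.
  let e := hS.toFinset.equivFin
  let C' : Cuts N d₁ := ⟨_, fun _ s => (e.symm s).1.1, fun _ s => (e.symm s).1.2⟩
  refine ((isPoly_lbDualFeasible (lam := lam) (p := p) (w := w) C').finite_extremePoints.image
    (dualCut p C')).subset ?_
  rintro _ ⟨C, hC, q, hq, rfl⟩
  let φ : Fin N → Fin C.num → Fin C'.num := fun i j =>
    e ⟨(C.slope i j, C.icpt i j), hS.mem_toFinset.2 (hC i j)⟩
  have hs (i j) : C.slope i j = C'.slope i (φ i j) := by simp [C', φ]
  have hi (i j) : C.icpt i j = C'.icpt i (φ i j) := by simp [C', φ]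
  refine ⟨_, mergeDual_mem_extremePoints hs hq, Prod.ext rfl ?_⟩
  have hm (i : Fin N) := sum_merge (φ i) (q.2.2.1 i) (C'.icpt i)
  simp only [smul_eq_mul] at hm
  simp only [dualCut, mergeDual, hm, hi]

end Finiteness

open Filter

/-! ### Validity of the approximations -/

section Bounds

variable {P : Problem} {t : ℕ} {i : Fin P.N}

namespace Problem

/-- Needed for the first stage, where all indices carry the same parameters but the drawn index is
arbitrary. -/
theorem weight_congr {i j : Fin P.N} (h : P.ξ t i = P.ξ t j) : P.weight t i = P.weight t j := by
  funext l
  simp only [weight, h]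

theorem stageObjective_congr {i j : Fin P.N} (h : P.ξ t i = P.ξ t j) :
    P.stageObjective t i = P.stageObjective t j := by
  funext x
  simp only [stageObjective, h, weight_congr h]

end Problem

/-- The auxiliary variables of the program are dual variables of the worst-case problem, so weak
duality applies to any overestimate `q` of the cost-to-go. -/
theorem stageObjective_le_lpCost {q : Fin P.N → ℝ} {x : Fin (P.d (t + 1)) → ℝ} {γ β : ℝ}
    {μ ζ ψ : Fin P.N → ℝ} (hβ : 0 ≤ β) (hμ : 0 ≤ μ) (hζ : 0 ≤ ζ) (hψ : 0 ≤ ψ)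
    (hx : ∀ j, P.costToGo (t + 1) x j ≤ q j)
    (hq : ∀ j, q j ≤ γ + (μ j - ζ j) / √(P.weight t i j))
    (he : ∀ j, μ j + ζ j = ψ j + β / √(P.N : ℝ)) :
    P.stageObjective t i x ≤ lpCost P.lam (P.ξ t i) (P.weight t i) x γ β μ ζ ψ := by
  have := worstCase_le_dual P.lam_nonneg (P.weight_pos t i) (P.sum_weight t i) hβ hμ hζ hψ
    (fun j => (hx j).trans (hq j)) he
  simp only [Problem.stageObjective, lpCost]
  linarith

theorem stageObjective_le_lbCost {C : Cuts P.N (P.d (t + 1))} {x : Fin (P.d t) → ℝ}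
    {v : PrimalVar P.N (P.d t) (P.d (t + 1))} (hv : v ∈ lbFeasible (P.ξ t i) (P.weight t i) C x)
    (hC : ∀ i, ∃ j, P.costToGo (t + 1) v.1 i ≤ C.slope i j ⬝ᵥ v.1 + C.icpt i j) :
    P.stageObjective t i v.1 ≤ lbCost P.lam (P.ξ t i) (P.weight t i) v := by
  obtain ⟨x', z, γ, β, μ, ζ, ψ⟩ := v
  obtain ⟨hx, hβ, hμ, hζ, hψ, hAB, rfl, hcut, he⟩ := hv
  choose j hj using hC
  exact stageObjective_le_lpCost hβ hμ hζ hψ hj (fun i => hcut i (j i)) he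

/-- Strong duality supplies auxiliary variables for the true cost-to-go vector; they are feasible
because cuts that lie below it are less demanding. -/
theorem stageObjective_mem_lbValues {C : Cuts P.N (P.d (t + 1))} {x : Fin (P.d t) → ℝ}
    {x' : Fin (P.d (t + 1)) → ℝ} (hx' : x' ∈ (P.ξ t i).region x)
    (hC : ∀ i j, C.slope i j ⬝ᵥ x' + C.icpt i j ≤ P.costToGo (t + 1) x' i) :
    P.stageObjective t i x' ∈ lbValues P.lam (P.ξ t i) (P.weight t i) C x := by
  obtain ⟨γ, β, μ, ζ, ψ, hβ, hμ, hζ, hψ, hq, he, hval⟩ := exists_dual_eq_worstCase P.lam_nonneg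
    (P.weight_pos t i) (P.sum_weight t i) (P.costToGo (t + 1) x')
  refine ⟨(x', x, γ, β, μ, ζ, ψ), ⟨hx'.1, hβ, hμ, hζ, hψ, hx'.2, rfl,
    fun i j => (hC i j).trans (hq i), he⟩, ?_⟩
  simp only [lbCost, lpCost, Problem.stageObjective, ← hval]
  ring

theorem stageObjective_mem_ubValues {I : InnerPoints P.N (P.d (t + 1))} {x : Fin (P.d t) → ℝ}
    {x' : Fin (P.d (t + 1)) → ℝ} (hx' : x' ∈ (P.ξ t i).region x)
    (hI : ∀ i, P.costToGo (t + 1) x' i ∈ innerValues I i x') :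
    P.stageObjective t i x' ∈ ubValues P.lam (P.ξ t i) (P.weight t i) I x := by
  obtain ⟨γ, β, μ, ζ, ψ, hβ, hμ, hζ, hψ, hq, he, hval⟩ := exists_dual_eq_worstCase P.lam_nonneg
    (P.weight_pos t i) (P.sum_weight t i) (P.costToGo (t + 1) x')
  refine ⟨x', γ, β, μ, ζ, ψ, P.costToGo (t + 1) x', hx'.1, hβ, hμ, hζ, hψ, hx'.2, hq, hI, he, ?_⟩
  simp only [lpCost, Problem.stageObjective, ← hval]
  ring

theorem costToGo_le_of_mem_ubValues (hA : P.RelativelyCompleteRecourse) (ht : t < P.T)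
    {I : InnerPoints P.N (P.d (t + 1))}
    (hI : ∀ x ∈ P.reachable (t + 1), ∀ i, ∀ v ∈ innerValues I i x, P.costToGo (t + 1) x i ≤ v)
    {x : Fin (P.d t) → ℝ} (hx : x ∈ P.reachable t) {v : ℝ}
    (hv : v ∈ ubValues P.lam (P.ξ t i) (P.weight t i) I x) : P.costToGo t x i ≤ v := by
  obtain ⟨x', γ, β, μ, ζ, ψ, q, hx', hβ, hμ, hζ, hψ, hAB, hq, hqI, he, rfl⟩ := hv
  have hreg : x' ∈ (P.ξ t i).region x := ⟨hx', hAB⟩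
  exact (Problem.costToGo_le hA ht hx hreg).trans <| stageObjective_le_lpCost hβ hμ hζ hψ
    (fun j => hI x' ⟨x, hx, i, hreg⟩ j _ (hqI j)) hq he

namespace Run

variable {R : Run P}

theorem cuts_of_ne (ht : t ≠ P.T) (n : ℕ) : R.cuts n t =
    ⟨n, fun i j => R.slope j t i, fun i j => R.vlow j t i - R.slope j t i ⬝ᵥ R.cand j t⟩ :=
  if_neg ht

theorem inner_of_ne (ht : t ≠ P.T) (n : ℕ) :
    R.inner n t = ⟨n, fun j => R.cand j t, fun i j => R.vup j t i, P.M t⟩ :=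
  if_neg ht

theorem cuts_horizon (n : ℕ) : R.cuts n P.T = Cuts.zero P.N (P.d P.T) := if_pos rfl

theorem inner_horizon (n : ℕ) : R.inner n P.T = InnerPoints.zero P.N (P.d P.T) := if_pos rfl

theorem Follows.cand_mem_reachable (hR : R.Follows) (k : ℕ) (ht : t ≤ P.T) :
    R.cand k t ∈ P.reachable t := by
  induction t with
  | zero => exact hR.start k
  | succ t ih => exact ⟨_, ih (by omega), _, hR.forward_feasible k t (by omega)⟩

/-- The cut that is added is the one generated by the dual solution. -/
theorem Follows.dualCut_eq (hR : R.Follows) {k : ℕ} (h1 : 1 ≤ t) (ht : t < P.T)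
    {q : DualVar P.N (P.d t) (P.m t) (R.cuts (k + 1) (t + 1)).num}
    (hq : q ∈ lbDualSolutions P.lam (P.ξ t i) (P.weight t i) (R.cuts (k + 1) (t + 1))
      (R.cand k t)) (hs : q.2.1 = R.slope k t i) :
    dualCut (P.ξ t i) (R.cuts (k + 1) (t + 1)) q =
      (R.slope k t i, R.vlow k t i - R.slope k t i ⬝ᵥ R.cand k t) := by
  have := lbDualValue_eq_of_mem_lbDualSolutions (P.weight_pos t i) (hR.backward_vlow k t h1 ht i) hq
  rw [lbDualValue_eq_dualCut] at this
  refine Prod.ext hs ?_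
  rw [← this, ← hs]
  simp [dualCut]

/-- The cuts are lower bounds of the cost-to-go functions. -/
theorem Follows.cut_le_costToGo (hA : P.RelativelyCompleteRecourse) (hR : R.Follows) {r t : ℕ}
    (hrt : t + r = P.T) (h1 : 1 ≤ t) (n : ℕ) {x : Fin (P.d t) → ℝ} (hx : x ∈ P.reachable t)
    (i : Fin P.N) (j : Fin (R.cuts n t).num) :
    (R.cuts n t).slope i j ⬝ᵥ x + (R.cuts n t).icpt i j ≤ P.costToGo t x i := by
  revert i j
  induction r generalizing t n with
  | zero =>
    obtain rfl : t = P.T := by omega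
    rw [cuts_horizon]
    intro i j
    simp [Cuts.zero, Problem.costToGo_horizon]
  | succ r ih =>
    have ht : t < P.T := by omega
    rw [cuts_of_ne ht.ne]
    intro i j
    -- The incoming state enters only the dual objective. The dual solution found at the candidate
    -- is thus feasible at every `x`, and the value of the cut at `x` is its dual objective there.
    obtain ⟨q, hq, hs⟩ := hR.backward_slope j t h1 ht i
    have hc := hR.dualCut_eq h1 ht hq hs
    have hval := lbDualValue_eq_dualCut (p := P.ξ t i) (R.cuts (j + 1) (t + 1)) q x
    rw [hc] at hval
    simp only at hval ⊢
    rw [← hval]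
    refine Problem.le_costToGo hA ht hx fun x' hx' => ?_
    obtain ⟨v, hv, hv'⟩ := stageObjective_mem_lbValues (C := R.cuts (j + 1) (t + 1)) hx'
      (ih (by omega) (by omega) _ ⟨x, hx, i, hx'⟩)
    rw [← hv']
    exact lbDualValue_le_lbCost (P.weight_pos t i) hq.1 hv

/-- The inner approximations are upper bounds of the cost-to-go functions. -/
theorem Follows.costToGo_le_inner (hA : P.RelativelyCompleteRecourse)
    (hM : P.PenaltyDominatesLipschitz) (hR : R.Follows) {r t : ℕ}
    (hrt : t + r = P.T) (h1 : 1 ≤ t) (n : ℕ) {x : Fin (P.d t) → ℝ} (hx : x ∈ P.reachable t)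
    (i : Fin P.N) {v : ℝ} (hv : v ∈ innerValues (R.inner n t) i x) : P.costToGo t x i ≤ v := by
  induction r generalizing t n i v with
  | zero =>
    obtain rfl : t = P.T := by omega
    rw [inner_horizon] at hv
    obtain ⟨θ, y, -, -, -, rfl⟩ := hv
    simp [InnerPoints.zero, Problem.costToGo_horizon]
  | succ r ih =>
    have ht : t < P.T := by omega
    rw [inner_of_ne ht.ne] at hv
    obtain ⟨θ, y, hθ, hθ1, hy, rfl⟩ := hv
    simp only at θ hθ hθ1 hy ⊢
    have hc (j : Fin n) : R.cand j t ∈ P.reachable t := hR.cand_mem_reachable j ht.le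
    have hup (j : Fin n) : P.costToGo t (R.cand j t) i ≤ R.vup j t i :=
      costToGo_le_of_mem_ubValues hA ht (fun x hx i v hv => ih (by omega) (by omega) _ hx i hv)
        (hc j) (hR.backward_vup j t h1 ht i).1
    -- Convexity bounds the cost-to-go at the combination of candidates, and the penalty pays for
    -- the displacement `y`. The combination may be unreachable, hence the Lipschitz condition on
    -- the convex hull.
    have hconv : ∑ j, θ j • R.cand j t ∈ convexHull ℝ (P.reachable t) :=
      (convex_convexHull ℝ _).sum_mem (fun j _ => hθ j) hθ1
        fun j _ => subset_convexHull ℝ _ (hc j)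
    have hlip := (abs_le.1 (hM t h1 ht i x (subset_convexHull ℝ _ hx) _ hconv)).2
    have hxy (l) : x l - (∑ j, θ j • R.cand j t) l = y l := by
      rw [← hy, Pi.add_apply, add_sub_cancel_left]
    simp only [hxy] at hlip
    have hsum := Problem.costToGo_sum_le hA ht.le i hθ hθ1 hc
    have hle : ∑ j, θ j * P.costToGo t (R.cand j t) i ≤ ∑ j : Fin n, θ j * R.vup j t i :=
      Finset.sum_le_sum fun j _ => mul_le_mul_of_nonneg_left (hup j) (hθ j)
    linarith

/-- Adding cuts can only raise optimal values, so a lower bound once tight is never lost. -/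
theorem lbFeasible_antitone {p : Param (P.d t) (P.d (t + 1)) (P.m t)} {w : Fin P.N → ℝ}
    {x : Fin (P.d t) → ℝ} {n n' : ℕ} (hn : n ≤ n') :
    lbFeasible p w (R.cuts n' (t + 1)) x ⊆ lbFeasible p w (R.cuts n (t + 1)) x := by
  by_cases ht : t + 1 = P.T
  · simp only [cuts, if_pos ht]
    exact subset_rfl
  · rw [cuts_of_ne ht, cuts_of_ne ht]
    rintro ⟨x', z, γ, β, μ, ζ, ψ⟩ ⟨hx, hβ, hμ, hζ, hψ, hAB, hz, hcut, he⟩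
    exact ⟨hx, hβ, hμ, hζ, hψ, hAB, hz, fun i j => hcut i (j.castLE hn), he⟩

/-! ### Finitely many cuts and candidates -/

/-- Backward induction: the horizon has the single zero cut, and a finite pool for stage `t + 1`
admits finitely many basic dual cuts for stage `t`. The pool is uniform over runs and iterations. -/
theorem exists_finite_cuts (P : Problem) {r t : ℕ} (hrt : t + r = P.T) (h1 : 1 ≤ t) :
    ∃ S : Set ((Fin (P.d t) → ℝ) × ℝ), S.Finite ∧
      ∀ R : Run P, R.Follows → R.DualBasic → ∀ n, (R.cuts n t).CutsIn S := by
  induction r generalizing t with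
  | zero =>
    obtain rfl : t = P.T := by omega
    refine ⟨{(0, 0)}, Set.finite_singleton _, fun R _ _ n => ?_⟩
    rw [cuts_horizon]
    exact fun i j => rfl
  | succ r ih =>
    obtain ⟨S, hS, H⟩ := ih (t := t + 1) (by omega) (by omega)
    refine ⟨_, Set.finite_iUnion fun i => finite_basic_cuts P.lam (P.ξ t i) (P.weight t i) hS,
      fun R hR hB n => ?_⟩
    have ht : t < P.T := by omega
    rw [cuts_of_ne ht.ne]
    intro i j
    obtain ⟨q, hq, hqe, hs⟩ := hB j t h1 ht i
    exact Set.mem_iUnion.2 ⟨i, _, H R hR hB _, q, hqe, hR.dualCut_eq h1 ht hq hs⟩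

/-- From the second iteration on, the candidates belong to a finite set that does not depend on the
execution. -/
theorem exists_finite_candidates (P : Problem) {t : ℕ} (ht : t ≤ P.T) :
    ∃ D : Set (Fin (P.d t) → ℝ), D.Finite ∧
      ∀ R : Run P, R.Follows → R.PrimalBasic → R.DualBasic → ∀ k, 0 < k → R.cand k t ∈ D := by
  induction t with
  | zero => exact ⟨{P.x₀}, Set.finite_singleton _, fun R hR _ _ k _ => hR.start k⟩
  | succ t ih =>
    obtain ⟨D, hD, H⟩ := ih (by omega)
    obtain ⟨S, hS, H'⟩ := exists_finite_cuts P (Nat.add_sub_of_le ht) (by omega)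
    refine ⟨_, hD.biUnion fun x _ => Set.finite_iUnion fun i =>
      finite_basic_decisions (P.ξ t i) (P.weight t i) x hS, fun R hR hB1 hB2 k hk => ?_⟩
    obtain ⟨v, -, hv, hv1⟩ := hB1 k t (by omega) (.inl hk)
    exact Set.mem_biUnion (H R hR hB1 hB2 k hk)
      (Set.mem_iUnion.2 ⟨R.sample k t, _, H' R hR hB2 k, v, hv, hv1⟩)

/-! ### Exactness at recurrent candidates -/

variable (R) in
/-- The values of `x_t` that are candidates infinitely often. -/
def recurrent (t : ℕ) : Set (Fin (P.d t) → ℝ) := {x | ∃ᶠ k in atTop, R.cand k t = x}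

theorem finite_recurrent {D : Set (Fin (P.d t) → ℝ)} (hD : D.Finite)
    (h : ∀ k, 0 < k → R.cand k t ∈ D) : (R.recurrent t).Finite := by
  refine hD.subset fun x hx => ?_
  obtain ⟨k, hk, hk0⟩ := (hx.and_eventually (eventually_gt_atTop 0)).exists
  exact hk ▸ h k hk0

theorem eventually_cand_mem_recurrent {D : Set (Fin (P.d t) → ℝ)} (hD : D.Finite)
    (h : ∀ k, 0 < k → R.cand k t ∈ D) : ∀ᶠ k in atTop, R.cand k t ∈ R.recurrent t := by
  have : ∀ᶠ k in atTop, ∀ x ∈ D, x ∉ R.recurrent t → R.cand k t ≠ x :=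
    (eventually_all_finite hD).2 fun x _ => by
      by_cases hx : x ∈ R.recurrent t
      · exact .of_forall fun k h => absurd hx h
      · exact (not_frequently.1 hx).mono fun k hk _ => hk
  filter_upwards [this, eventually_gt_atTop 0] with k hk hk0
  by_contra hc
  exact hk _ (h k hk0) hc rfl

variable (R) in
/-- The approximations of the cost-to-go functions of the state `x_t` by the first `n` iterations
are exact at `x`. -/
def ExactAt (n t : ℕ) (x : Fin (P.d t) → ℝ) : Prop :=
  ∀ i, (∃ j, (R.cuts n t).slope i j ⬝ᵥ x + (R.cuts n t).icpt i j = P.costToGo t x i) ∧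
    P.costToGo t x i ∈ innerValues (R.inner n t) i x

variable (R) in
/-- The lower and upper bound problems after `n` iterations have optimal value `costToGo` at `x`. -/
def BoundsExactAt (n t : ℕ) (x : Fin (P.d t) → ℝ) : Prop :=
  ∀ i, IsLeast (lbValues P.lam (P.ξ t i) (P.weight t i) (R.cuts n (t + 1)) x)
      (P.costToGo t x i) ∧
    IsLeast (ubValues P.lam (P.ξ t i) (P.weight t i) (R.inner n (t + 1)) x) (P.costToGo t x i)

theorem exactAt_horizon (n : ℕ) (x : Fin (P.d P.T) → ℝ) : R.ExactAt n P.T x := by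
  intro i
  rw [cuts_horizon, inner_horizon, Problem.costToGo_horizon]
  exact ⟨⟨(0 : Fin 1), by simp [Cuts.zero]⟩,
    fun _ => 1, x, fun _ => zero_le_one, Fin.sum_univ_one _,
    by simp [InnerPoints.zero], by simp [InnerPoints.zero]⟩

/-- If the cuts are exact at the candidate, it is an optimal decision. -/
theorem Follows.forward_exact (hA : P.RelativelyCompleteRecourse) (hR : R.Follows) (ht : t < P.T)
    {k : ℕ} (hk : 0 < k) (hex : R.ExactAt k (t + 1) (R.cand k (t + 1)))
    (hi : P.ξ t (R.sample k t) = P.ξ t i) :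
    P.stageObjective t i (R.cand k (t + 1)) = P.costToGo t (R.cand k t) i ∧
      P.costToGo t (R.cand k t) i ∈ lowerBounds
        (lbValues P.lam (P.ξ t i) (P.weight t i) (R.cuts k (t + 1)) (R.cand k t)) := by
  obtain ⟨v, ⟨hv, hmin⟩, hvc⟩ := hR.forward_optimal k t ht (.inl hk)
  have hreg := hR.forward_feasible k t ht
  rw [hi, Problem.weight_congr hi] at hv hmin
  rw [hi] at hreg
  have hx := hR.cand_mem_reachable k ht.le
  rw [← hvc] at hex hreg ⊢
  -- Exact cuts at the candidate give true objective `≤` program value (`h1`), valid cuts give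
  -- program value `≤` cost-to-go (`h3`), and feasibility gives cost-to-go `≤` true objective
  -- (`h2`). All three coincide.
  have h1 := stageObjective_le_lbCost hv fun j => (hex j).1.imp fun _ h => h.ge
  have h2 := Problem.costToGo_le hA ht hx hreg
  have h3 : lbCost P.lam (P.ξ t i) (P.weight t i) v ≤ P.costToGo t (R.cand k t) i := by
    refine Problem.le_costToGo hA ht hx fun x' hx' => ?_
    obtain ⟨v', hv', he⟩ := stageObjective_mem_lbValues (C := R.cuts k (t + 1)) hx'
      (hR.cut_le_costToGo hA (Nat.add_sub_of_le ht) (by omega) k ⟨_, hx, i, hx'⟩)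
    rw [← he]
    exact hmin hv'
  refine ⟨by linarith, ?_⟩
  rintro _ ⟨v', hv', rfl⟩
  exact (h2.trans h1).trans (hmin hv')

/-- For recurrent `x` and observation `i`, some late iteration visits `x`, draws `i` and moves to a
recurrent state where the approximations are exact. By `forward_exact` that move is optimal, and it
attains the common value in both bound problems from then on. -/
theorem Follows.eventually_boundsExactAt (hA : P.RelativelyCompleteRecourse)
    (hM : P.PenaltyDominatesLipschitz) (hR : R.Follows) (ht : t < P.T)
    (hfin : (R.recurrent t).Finite)
    (hrec : ∀ᶠ k in atTop, R.cand k (t + 1) ∈ R.recurrent (t + 1))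
    (hsample : ∀ x ∈ R.recurrent t, ∀ i,
      ∃ᶠ k in atTop, R.cand k t = x ∧ P.ξ t (R.sample k t) = P.ξ t i)
    (hex : ∀ᶠ k in atTop, ∀ x ∈ R.recurrent (t + 1), R.ExactAt k (t + 1) x) :
    ∀ᶠ k in atTop, ∀ x ∈ R.recurrent t, R.BoundsExactAt k t x := by
  refine (eventually_all_finite hfin).2 fun x hx => eventually_all.2 fun i => ?_
  obtain ⟨k₀, ⟨rfl, hi⟩, hmem, hex₀, hk₀⟩ := ((hsample x hx i).and_eventually
    (hrec.and (hex.and (eventually_gt_atTop 0)))).exists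
  obtain ⟨hobj, hlow⟩ := hR.forward_exact hA ht hk₀ (hex₀ _ hmem) hi
  have hreg := hR.forward_feasible k₀ t ht
  rw [hi] at hreg
  have hreach := hR.cand_mem_reachable k₀ ht
  filter_upwards [hex, eventually_ge_atTop k₀] with k hk hkk
  refine ⟨⟨?_, fun c hc => hlow (Set.image_mono (lbFeasible_antitone hkk) hc)⟩, ?_,
    fun c hc => costToGo_le_of_mem_ubValues hA ht (fun x hx i v hv =>
      hR.costToGo_le_inner hA hM (Nat.add_sub_of_le ht) (by omega) k hx i hv)
      (hR.cand_mem_reachable k₀ ht.le) hc⟩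
  · rw [← hobj]
    exact stageObjective_mem_lbValues hreg
      (hR.cut_le_costToGo hA (Nat.add_sub_of_le ht) (by omega) k hreach)
  · rw [← hobj]
    exact stageObjective_mem_ubValues hreg fun j => (hk _ hmem j).2

theorem Follows.eventually_exactAt_of_bounds (hR : R.Follows) (h1 : 1 ≤ t) (ht : t < P.T)
    (hfin : (R.recurrent t).Finite)
    (hb : ∀ᶠ k in atTop, ∀ x ∈ R.recurrent t, R.BoundsExactAt k t x) :
    ∀ᶠ k in atTop, ∀ x ∈ R.recurrent t, R.ExactAt k t x := by
  refine (eventually_all_finite hfin).2 fun x hx => ?_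
  -- The backward pass of iteration `k₀` already uses the cuts and points of stage `t + 1` from that
  -- iteration, so exactness is required at index `k₀ + 1`. The resulting cut and point at `x` are
  -- kept forever.
  obtain ⟨k₀, rfl, hk₀⟩ := (Frequently.and_eventually hx
    ((tendsto_add_atTop_nat 1).eventually hb)).exists
  have hbx := hk₀ _ hx
  filter_upwards [eventually_gt_atTop k₀] with k hk i
  have hlow := (hR.backward_vlow k₀ t h1 ht i).unique (hbx i).1
  have hup := (hR.backward_vup k₀ t h1 ht i).unique (hbx i).2
  rw [cuts_of_ne ht.ne, inner_of_ne ht.ne]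
  refine ⟨⟨⟨k₀, hk⟩, ?_⟩, Pi.single (⟨k₀, hk⟩ : Fin k) 1, 0, ?_, ?_, ?_, ?_⟩
  · simp [hlow]
  · exact Pi.single_nonneg.2 zero_le_one
  · simp
  · simp [Pi.single_apply]
  · simp [Pi.single_apply, hup]

theorem Follows.eventually_exactAt (hA : P.RelativelyCompleteRecourse)
    (hM : P.PenaltyDominatesLipschitz) (hR : R.Follows)
    (hfin : ∀ t ≤ P.T, (R.recurrent t).Finite)
    (hrec : ∀ t ≤ P.T, ∀ᶠ k in atTop, R.cand k t ∈ R.recurrent t)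
    (hsample : ∀ t < P.T, ∀ x ∈ R.recurrent t, ∀ i,
      ∃ᶠ k in atTop, R.cand k t = x ∧ P.ξ t (R.sample k t) = P.ξ t i)
    {r t : ℕ} (hrt : t + r = P.T) (h1 : 1 ≤ t) :
    ∀ᶠ k in atTop, ∀ x ∈ R.recurrent t, R.ExactAt k t x := by
  induction r generalizing t with
  | zero =>
    obtain rfl : t = P.T := by omega
    exact .of_forall fun k x _ => exactAt_horizon k x
  | succ r ih =>
    have ht : t < P.T := by omega
    exact hR.eventually_exactAt_of_bounds h1 ht (hfin t ht.le) <|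
      hR.eventually_boundsExactAt hA hM ht (hfin t ht.le) (hrec _ ht) (hsample t ht)
        (ih (by omega) (by omega))

/-- Finite convergence of an execution in which all successors of recurrent candidates are sampled
infinitely often. -/
theorem Follows.finite_convergence (hA : P.RelativelyCompleteRecourse)
    (hM : P.PenaltyDominatesLipschitz) (hR : R.Follows)
    (hfin : ∀ t ≤ P.T, (R.recurrent t).Finite)
    (hrec : ∀ t ≤ P.T, ∀ᶠ k in atTop, R.cand k t ∈ R.recurrent t)
    (hsample : ∀ t < P.T, ∀ x ∈ R.recurrent t, ∀ i,
      ∃ᶠ k in atTop, R.cand k t = x ∧ P.ξ t (R.sample k t) = P.ξ t i) :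
    ∃ K : ℕ, ∀ k ≥ K,
      (∀ i, R.cand k 1 ∈ (P.ξ 0 i).region P.x₀ ∧
        IsMinOn (P.stageObjective 0 i) ((P.ξ 0 i).region P.x₀) (R.cand k 1)) ∧
      (∀ k' ≥ K, ∀ t < P.T, R.BoundsExactAt (k + 1) t (R.cand k' t)) ∧
      ∀ k' ≥ K, ∀ t, 1 ≤ t → t < P.T → R.ExactAt (k + 1) t (R.cand k' t) := by
  have hex {t : ℕ} (h1 : 1 ≤ t) (ht : t ≤ P.T) :=
    hR.eventually_exactAt hA hM hfin hrec hsample (Nat.add_sub_of_le ht) h1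
  have hall : ∀ᶠ k in atTop, ∀ t ∈ Set.Iio P.T, R.cand k t ∈ R.recurrent t ∧
      (∀ x ∈ R.recurrent t, R.BoundsExactAt k t x) ∧
      (1 ≤ t → ∀ x ∈ R.recurrent t, R.ExactAt k t x) :=
    (eventually_all_finite (Set.finite_Iio P.T)).2 fun t (ht : t < P.T) =>
      (hrec t ht.le).and <| (hR.eventually_boundsExactAt hA hM ht (hfin t ht.le) (hrec _ ht)
        (hsample t ht) (hex (by omega) ht)).and <| by
          by_cases h1 : 1 ≤ t
          · exact (hex h1 ht.le).mono fun k hk _ => hk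
          · exact .of_forall fun k h => absurd h h1
  -- Exactness at `x_1` is listed separately because for `T = 1` it is the horizon, outside the
  -- range `t < T`.
  obtain ⟨K, hK⟩ := eventually_atTop.1 (hall.and ((hrec 1 P.T_pos).and
    ((hex le_rfl P.T_pos).and (eventually_gt_atTop 0))))
  refine ⟨K, fun k hk => ⟨fun i => ?_, fun k' hk' t ht => ?_, fun k' hk' t h1 ht => ?_⟩⟩
  · obtain ⟨-, hc, he, hk0⟩ := hK k hk
    have hi : P.ξ 0 (R.sample k 0) = P.ξ 0 i := P.first_stage _ _
    have hreg := hR.forward_feasible k 0 P.T_pos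
    obtain ⟨hobj, -⟩ := hR.forward_exact hA P.T_pos hk0 (he _ hc) hi
    have hx := hR.cand_mem_reachable k P.T_pos.le
    rw [hi] at hreg
    rw [hR.start] at hreg hobj hx
    refine ⟨hreg, fun x' hx' => ?_⟩
    change P.stageObjective 0 i (R.cand k 1) ≤ _
    rw [hobj]
    exact Problem.costToGo_le hA P.T_pos hx hx'
  · exact ((hK (k + 1) (by omega)).1 t ht).2.1 _ ((hK k' hk').1 t ht).1
  · exact ((hK (k + 1) (by omega)).1 t ht).2.2 h1 _ ((hK k' hk').1 t ht).1

end Run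

end Bounds

open Filter MeasureTheory

/-! ### Recurrent sampling -/

theorem tendsto_sum_atTop_of_frequently_ge {u : ℕ → ℝ} (h0 : ∀ n, 0 ≤ u n) {c : ℝ} (hc : 0 < c)
    (hu : ∃ᶠ n in atTop, c ≤ u n) :
    Tendsto (fun n => ∑ k ∈ Finset.range n, u k) atTop atTop := by
  refine (not_summable_iff_tendsto_nat_atTop_of_nonneg h0).1 fun hs => ?_
  obtain ⟨n, h1, h2⟩ :=
    (hu.and_eventually (hs.tendsto_atTop_zero.eventually_lt_const hc)).exists
  exact absurd h1 (not_le.2 h2)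

/-- Almost surely, every observation is drawn infinitely often at a state that is visited
infinitely often. -/
theorem MonteCarlo.ae_frequently_sample {P : Problem} {Ω : Type*} [mΩ : MeasurableSpace Ω]
    {μ : Measure Ω} [IsProbabilityMeasure μ] {ℱ : Filtration (ℕ ×ₗ ℕ) mΩ} {R : Ω → Run P}
    (hMC : MonteCarlo P μ ℱ R) {s : ℕ} (hs : s + 1 < P.T) (x : Fin (P.d (s + 1)) → ℝ)
    (i : Fin P.N) : ∀ᵐ ω ∂μ, (∃ᶠ k in atTop, (R ω).cand k (s + 1) = x) →
      ∃ᶠ k in atTop, (R ω).cand k (s + 1) = x ∧ (R ω).sample k (s + 1) = i := by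
  -- `G n` is the information just before the relevant draw of iteration `n`. The outcome is known
  -- only by time `n + 1`, hence the shift in `S`, with an empty event at time `0`.
  let G : Filtration ℕ mΩ :=
    ⟨fun n => ℱ (toLex (n, s + 1)), fun a b hab => ℱ.mono (by
      rcases hab.eq_or_lt with rfl | h
      · exact le_rfl
      · exact (Prod.Lex.toLex_lt_toLex.2 (.inl h)).le), fun n => ℱ.le _⟩
  let X : ℕ → Set Ω := fun n => {ω | (R ω).cand n (s + 1) = x}
  let Y : ℕ → Set Ω := fun n => {ω | (R ω).sample n (s + 1) = i}
  have hX (n) : MeasurableSet[G n] (X n) :=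
    hMC.cand_adapted n (s + 1) hs.le (measurableSet_singleton x)
  have hY (n) : MeasurableSet[G (n + 1)] (Y n) :=
    ℱ.mono (Prod.Lex.toLex_lt_toLex.2 (.inl (Nat.lt_succ_self n))).le _
      (hMC.sample_adapted n (s + 1) hs (measurableSet_singleton i))
  let S : ℕ → Set Ω := fun n => n.casesOn ∅ fun n => X n ∩ Y n
  have hS (n) : MeasurableSet[G n] (S n) := by
    cases n with
    | zero => exact @MeasurableSet.empty _ (G 0)
    | succ n => exact (G.mono (Nat.le_succ n) _ (hX n)).inter (hY n)
  -- The least weight of observation `i` over the finitely many preceding observations is a uniform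
  -- positive lower bound for its conditional probability.
  obtain ⟨j₀, -, hj₀⟩ := Finset.univ.exists_min_image (fun j => P.weight s j i) ⟨i, Finset.mem_univ _⟩
  have hcond (n) : μ[(S (n + 1)).indicator (1 : Ω → ℝ) | G n] =ᵐ[μ]
      (X n).indicator fun ω => P.weight s ((R ω).sample n s) i := by
    have e : (S (n + 1)).indicator (1 : Ω → ℝ) =
        (X n).indicator ((Y n).indicator fun _ => (1 : ℝ)) := by
      rw [Set.indicator_indicator]; rfl
    rw [e]
    have hint : Integrable ((Y n).indicator fun _ => (1 : ℝ)) μ :=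
      (integrable_const 1).indicator (G.le _ _ (hY n))
    refine (condExp_indicator hint (hX n)).trans ?_
    filter_upwards [hMC.conditional_law n s hs i] with ω hω
    simp only [Set.indicator]
    split_ifs
    · exact hω
    · rfl
  -- Conditional Borel–Cantelli: the events recur exactly where the conditional probabilities have
  -- divergent sum, which holds as each visit to `x` contributes at least the least weight.
  filter_upwards [ae_mem_limsup_atTop_iff (ℱ := G) μ hS, ae_all_iff.2 hcond] with ω hlim hω hfreq
  have hmem : ω ∈ limsup S atTop := by
    rw [hlim]
    simp only [hω]
    refine tendsto_sum_atTop_of_frequently_ge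
      (fun n => Set.indicator_nonneg (fun ω _ => (P.weight_pos s _ i).le) ω)
      (P.weight_pos s j₀ i) (hfreq.mono fun n hn => ?_)
    rw [Set.indicator_of_mem (show ω ∈ X n from hn)]
    exact hj₀ _ (Finset.mem_univ _)
  rw [mem_limsup_iff_frequently_mem] at hmem
  refine frequently_atTop.2 fun a => ?_
  obtain ⟨b, hb, hbS⟩ := frequently_atTop.1 hmem (a + 1)
  obtain ⟨b, rfl⟩ : ∃ b', b = b' + 1 := ⟨b - 1, by omega⟩
  exact ⟨b, by omega, hbS⟩

end RDDSDDP

/-! ### The main theorem -/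

open RDDSDDP MeasureTheory in
theorem mainTheorem3 (P : Problem)
    (hA3 : P.RelativelyCompleteRecourse)
    (hM : P.PenaltyDominatesLipschitz)
    {Ω : Type*} [mΩ : MeasurableSpace Ω] (μ : Measure Ω) [IsProbabilityMeasure μ]
    (ℱ : Filtration (ℕ ×ₗ ℕ) mΩ) (R : Ω → Run P)
    (hR : ∀ ω, (R ω).Follows)
    (hMC : MonteCarlo P μ ℱ R)
    (hB1 : ∀ ω, (R ω).PrimalBasic)
    (hB2 : ∀ ω, (R ω).DualBasic) :
    ∀ᵐ ω ∂μ, ∃ K : ℕ, ∀ k ≥ K,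
      -- the first-stage candidate is an optimal solution of the first-stage robust problem
      (∀ i, (R ω).cand k 1 ∈ (P.ξ 0 i).region P.x₀ ∧
        IsMinOn (P.stageObjective 0 i) ((P.ξ 0 i).region P.x₀) ((R ω).cand k 1)) ∧
      -- the lower and upper bound problems have the same optimal value, the true cost-to-go, at
      -- all candidates; for `t = 0` these are the bounds `LB` and `UB`
      (∀ k' ≥ K, ∀ t < P.T, ∀ i,
        IsLeast (lbValues P.lam (P.ξ t i) (P.weight t i) ((R ω).cuts (k + 1) (t + 1))
          ((R ω).cand k' t)) (P.costToGo t ((R ω).cand k' t) i) ∧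
        IsLeast (ubValues P.lam (P.ξ t i) (P.weight t i) ((R ω).inner (k + 1) (t + 1))
          ((R ω).cand k' t)) (P.costToGo t ((R ω).cand k' t) i)) ∧
      -- and so do the maximum of the cuts and the inner approximation
      (∀ k' ≥ K, ∀ t, 1 ≤ t → t < P.T → ∀ i,
        IsGreatest (Set.range fun j => ((R ω).cuts (k + 1) t).slope i j ⬝ᵥ (R ω).cand k' t +
          ((R ω).cuts (k + 1) t).icpt i j) (P.costToGo t ((R ω).cand k' t) i) ∧
        IsLeast (innerValues ((R ω).inner (k + 1) t) i ((R ω).cand k' t))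
          (P.costToGo t ((R ω).cand k' t) i)) := by
  -- The sets `D t` do not depend on `ω`, so only finitely many exceptional null sets, one for each
  -- stage, state and observation, have to be discarded.
  choose! D hD hDmem using fun t (ht : t ≤ P.T) => Run.exists_finite_candidates P ht
  have hsample : ∀ᵐ ω ∂μ, ∀ s ∈ Set.Iio P.T, s + 1 < P.T → ∀ x ∈ D (s + 1), ∀ i,
      (∃ᶠ k in Filter.atTop, (R ω).cand k (s + 1) = x) →
      ∃ᶠ k in Filter.atTop, (R ω).cand k (s + 1) = x ∧ (R ω).sample k (s + 1) = i := by
    refine (Filter.eventually_all_finite (Set.finite_Iio P.T)).2 fun s _ => ?_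
    by_cases hs : s + 1 < P.T
    · have := (Filter.eventually_all_finite (hD (s + 1) hs.le)).2 fun x _ =>
        Filter.eventually_all.2 fun i => hMC.ae_frequently_sample hs x i
      exact this.mono fun ω h _ => h
    · exact .of_forall fun ω h => absurd h hs
  filter_upwards [hsample] with ω hω
  have hmem (t : ℕ) (ht : t ≤ P.T) (k : ℕ) (hk : 0 < k) : (R ω).cand k t ∈ D t :=
    hDmem t ht (R ω) (hR ω) (hB1 ω) (hB2 ω) k hk
  obtain ⟨K, hK⟩ := (hR ω).finite_convergence hA3 hM
    (fun t ht => Run.finite_recurrent (hD t ht) (hmem t ht))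
    (fun t ht => Run.eventually_cand_mem_recurrent (hD t ht) (hmem t ht))
    (fun t ht x hx i => by
      cases t with
      -- In the first stage every draw yields the same parameters, so no randomness is needed.
      | zero => exact hx.mono fun k hk => ⟨hk, P.first_stage _ _⟩
      | succ s =>
        obtain ⟨k, hk, hk0⟩ := (hx.and_eventually (Filter.eventually_gt_atTop 0)).exists
        exact (hω s (Nat.lt_of_succ_lt ht) ht x (hk ▸ hmem _ ht.le k hk0) i hx).mono
          fun k hk => ⟨hk.1, congrArg _ hk.2⟩)
  refine ⟨K, fun k hk => ⟨(hK k hk).1, (hK k hk).2.1, fun k' hk' t h1 ht i => ?_⟩⟩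
  have hex := (hK k hk).2.2 k' hk' t h1 ht i
  have hreach := (hR ω).cand_mem_reachable k' ht.le
  -- Exactness provides attainment; the opposite inequalities are the general validity of cuts and
  -- inner approximations at reachable states.
  refine ⟨⟨hex.1, ?_⟩, hex.2, fun v hv =>
    (hR ω).costToGo_le_inner hA3 hM (Nat.add_sub_of_le ht.le) h1 _ hreach i hv⟩
  rintro _ ⟨j, rfl⟩
  exact (hR ω).cut_le_costToGo hA3 (Nat.add_sub_of_le ht.le) h1 _ hreach i j
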